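/- Let $M$ be a compact connected complex manifold of complex dimension $n$, with complex structure $J$, and let $(g,\theta)$ be a locally conformally Kähler (lcK) structure on $M$: $g$ is a smooth Riemannian metric for which $J$ is skew-symmetric, with fundamental $2$-form $\Omega=g(J\cdot,\cdot)$, and $\theta$ is a $1$-form (the Lee form, determined by $g$ if $n\ge 2$) such that every point of $M$ has an open neighbourhood $U$ and a smooth function $\varphi$ on $U$ for which $e^{-\varphi}g$ is Kähler on $U$ (i.e. $d(e^{-\varphi}\Omega)=0$ on $U$) and $\theta|_U=d\varphi$. Assume that the structure is strict, i.e. $\theta\neq d\varphi$ for every $\varphi\in C^\infty(M)$. Let the torus $T^m=(S^1)^m$ act on $M$ smoothly, effectively and by biholomorphisms, and suppose that the action is twisted Hamiltonian: for every fundamental vector field $X$ of the action there is $h\in C^\infty(M)$ with $\Omega(X,\cdot)=dh-h\,\theta$. Then every orbit of the action is isotropic for $\Omega$, i.e. $\Omega$ vanishes on each pair of vectors tangent to the orbit at the same point, and $m\le n$. -/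

import Mathlib

open scoped Manifold ContDiff

noncomputable section

namespace LcK

/-! ### Complex manifolds as real manifolds -/

/-- The model space of a complex manifold of complex dimension `n`. -/
abbrev Model (n : ℕ) : Type := EuclideanSpace ℂ (Fin n)

/-- A complex manifold is a real smooth (even real analytic) manifold for the same atlas. -/
instance isManifold_real {n : ℕ} {M : Type*} [TopologicalSpace M] [ChartedSpace (Model n) M]
    [IsManifold 𝓘(ℂ, Model n) ω M] : IsManifold 𝓘(ℝ, Model n) ω M := by
  apply isManifold_of_contDiffOn
  intro e e' he he'
  have h := (contDiffGroupoid ω 𝓘(ℂ, Model n)).compatible he he'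
  rw [contDiffGroupoid, mem_groupoid_of_pregroupoid] at h
  exact ContDiffOn.restrict_scalars ℝ h.1

/-! ### Differential forms and the exterior derivative on a manifold -/

section Forms

variable {E : Type*} [NormedAddCommGroup E] [NormedSpace ℝ E]
  {M : Type*} [TopologicalSpace M] [ChartedSpace E M] {k : ℕ}

variable (E M k) in
/-- A (not necessarily smooth) real differential `k`-form on `M`. -/
abbrev Form : Type _ := (x : M) → TangentSpace 𝓘(ℝ, E) x [⋀^Fin k]→L[ℝ] ℝ

/-- The expression of a `k`-form in the preferred chart at `c`: its pullback by the inverse of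
that chart. It is meaningful on the (open) target of the chart. -/
def Form.inChart (η : Form E M k) (c : M) (y : E) : E [⋀^Fin k]→L[ℝ] ℝ :=
  (η ((chartAt E c).symm y)).compContinuousLinearMap
    (mfderiv 𝓘(ℝ, E) 𝓘(ℝ, E) (chartAt E c).symm y)

/-- The exterior derivative of a `k`-form: at `x`, the exterior derivative of the expression of the
form in the chart at `x`, pulled back to `T_x M` by that chart. -/
def Form.d (η : Form E M k) : Form E M (k + 1) := fun x =>
  (extDeriv (η.inChart x) (chartAt E x x)).compContinuousLinearMap
    (mfderiv 𝓘(ℝ, E) 𝓘(ℝ, E) (chartAt E x) x)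

variable (E) in
/-- The differential of a real function, at `x`, as a linear form on `T_x M`. -/
def diff (f : M → ℝ) (x : M) : TangentSpace 𝓘(ℝ, E) x →L[ℝ] ℝ :=
  mfderiv 𝓘(ℝ, E) 𝓘(ℝ, ℝ) f x

/-- The twisted differential on functions: `d^θ f = df - f θ`. -/
def twistedDiff (θ : (x : M) → TangentSpace 𝓘(ℝ, E) x →L[ℝ] ℝ) (f : M → ℝ) (x : M) :
    TangentSpace 𝓘(ℝ, E) x →L[ℝ] ℝ :=
  diff E f x - f x • θ x

end Forms

/-! ### Hermitian metrics and lcK structures -/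

section Structures

variable {n : ℕ} {M : Type*} [TopologicalSpace M] [ChartedSpace (Model n) M]

/-- The complex structure `J` on the tangent spaces of a complex manifold: multiplication by `i`. -/
def complexStructure (x : M) :
    TangentSpace 𝓘(ℝ, Model n) x →L[ℝ] TangentSpace 𝓘(ℝ, Model n) x :=
  (Complex.I • ContinuousLinearMap.id ℝ (Model n) : Model n →L[ℝ] Model n)

variable [IsManifold 𝓘(ℂ, Model n) ω M]

variable (n M) in
/-- A smooth Riemannian metric `g` for which `J` is skew-symmetric. -/
structure HermitianMetric extends
    Bundle.ContMDiffRiemannianMetric 𝓘(ℝ, Model n) ∞ (Model n)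
      (fun x : M => TangentSpace 𝓘(ℝ, Model n) x) where
  skew (x : M) (v w : TangentSpace 𝓘(ℝ, Model n) x) :
    inner x (complexStructure x v) w = -inner x v (complexStructure x w)

/-- The fundamental `2`-form `Ω = g(J·, ·)`. -/
def HermitianMetric.fundamentalForm (g : HermitianMetric n M) : Form (Model n) M 2 := fun x =>
  { toFun := fun v => g.inner x (complexStructure x (v 0)) (v 1)
    map_update_add' := by
      intro _ v i a b
      fin_cases i <;> simp [Function.update]
    map_update_smul' := by
      intro _ v i c a
      fin_cases i <;> simp [Function.update]
    map_eq_zero_of_eq' := by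
      intro v i j hij hne
      have key : ∀ a : TangentSpace 𝓘(ℝ, Model n) x,
          g.inner x (complexStructure x a) a = 0 := by
        intro a
        have h1 := g.skew x a a
        have h2 := g.symm x (complexStructure x a) a
        linarith
      have h01 : v 0 = v 1 := by
        fin_cases i <;> fin_cases j <;> simp_all
      simp only [h01]
      exact key _
    cont := by
      have h : ∀ (B : Model n →L[ℝ] Model n →L[ℝ] ℝ) (J : Model n →L[ℝ] Model n),
          Continuous fun v : Fin 2 → Model n => B (J (v 0)) (v 1) := by
        intro B J
        fun_prop
      exact h (g.inner x) (complexStructure x) }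

theorem HermitianMetric.fundamentalForm_apply (g : HermitianMetric n M) (x : M)
    (v w : TangentSpace 𝓘(ℝ, Model n) x) :
    g.fundamentalForm x ![v, w] = g.inner x (complexStructure x v) w := rfl

/-- `θ` is the Lee form of the lcK metric `g`: around every point there are an open set `U` and a
smooth function `φ` on `U` such that the Hermitian metric `e^{-φ} g` is Kähler on `U`, that is, its
fundamental form `e^{-φ} Ω` is closed on `U`, and such that `θ = dφ` on `U`. -/
def IsLeeForm (g : HermitianMetric n M)
    (θ : (x : M) → TangentSpace 𝓘(ℝ, Model n) x →L[ℝ] ℝ) : Prop :=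
  ∀ x : M, ∃ (U : Set M) (φ : M → ℝ), IsOpen U ∧ x ∈ U ∧
    ContMDiffOn 𝓘(ℝ, Model n) 𝓘(ℝ, ℝ) ∞ φ U ∧
    ∀ y ∈ U, Form.d (fun z => Real.exp (-φ z) • g.fundamentalForm z) y = 0 ∧
      θ y = diff (Model n) φ y

variable (n M) in
/-- An lcK structure `(g, θ)` on the complex manifold `M`: a Hermitian metric `g` which is locally
conformally Kähler, and its Lee form `θ` (determined by `g` if `n ≥ 2`). -/
structure LcKStructure where
  metric : HermitianMetric n M
  leeForm : (x : M) → TangentSpace 𝓘(ℝ, Model n) x →L[ℝ] ℝ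
  isLeeForm : IsLeeForm metric leeForm

/-- The fundamental `2`-form of an lcK structure. -/
abbrev LcKStructure.Ω (S : LcKStructure n M) : Form (Model n) M 2 := S.metric.fundamentalForm

/-- The lcK structure is strict: its Lee form is not exact. -/
def LcKStructure.IsStrict (S : LcKStructure n M) : Prop :=
  ¬ ∃ φ : M → ℝ, ContMDiff 𝓘(ℝ, Model n) 𝓘(ℝ, ℝ) ∞ φ ∧ ∀ x, S.leeForm x = diff (Model n) φ x

/-- A vector field `X` is twisted Hamiltonian: `X ⌟ Ω = d^θ h` for some smooth function `h`. -/
def LcKStructure.IsTwistedHamiltonianField (S : LcKStructure n M)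
    (X : (x : M) → TangentSpace 𝓘(ℝ, Model n) x) : Prop :=
  ∃ h : M → ℝ, ContMDiff 𝓘(ℝ, Model n) 𝓘(ℝ, ℝ) ∞ h ∧
    ∀ (x : M) (v : TangentSpace 𝓘(ℝ, Model n) x),
      S.Ω x ![X x, v] = twistedDiff S.leeForm h x v

end Structures

/-! ### Actions of Lie groups -/

section Actions

variable {EG HG : Type*} [NormedAddCommGroup EG] [NormedSpace ℝ EG] [TopologicalSpace HG]
  (I : ModelWithCorners ℝ EG HG) {G : Type*} [TopologicalSpace G] [ChartedSpace HG G] [Group G]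
  {n : ℕ} {M : Type*} [TopologicalSpace M] [ChartedSpace (Model n) M] [MulAction G M]

/-- The fundamental vector field of `ξ ∈ Lie(G) = T_1 G`: its value at `x` is the image of `ξ` under
the differential at `1` of the orbit map `a ↦ a • x` (a vector at `1 • x = x`). -/
def fundamentalField (ξ : GroupLieAlgebra I G) (x : M) : TangentSpace 𝓘(ℝ, Model n) x :=
  (mfderiv I 𝓘(ℝ, Model n) (fun a : G => a • x) 1 ξ : Model n)

variable [IsManifold 𝓘(ℂ, Model n) ω M]

variable (G) in
/-- The action of `G` is twisted Hamiltonian: all its fundamental vector fields are. -/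
def LcKStructure.IsTwistedHamiltonianAction (S : LcKStructure n M) : Prop :=
  ∀ ξ : GroupLieAlgebra I G, S.IsTwistedHamiltonianField (fundamentalField I ξ)

variable (G) in
/-- The orbit of `x` under `G` is isotropic for the `2`-form `η`: at each of its points `a • x`, the
form vanishes on pairs of vectors tangent to the orbit, the tangent space of the orbit at `a • x`
being the image of the differential at `a` of the orbit map of `x`. -/
def IsIsotropicOrbit (η : Form (Model n) M 2) (x : M) : Prop :=
  ∀ (a : G) (v w : TangentSpace I a),
    η (a • x) ![mfderiv I 𝓘(ℝ, Model n) (fun b : G => b • x) a v,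
      mfderiv I 𝓘(ℝ, Model n) (fun b : G => b • x) a w] = 0

end Actions

/-- The standard torus `T^m`, a product of `m` circles. -/
abbrev Torus (m : ℕ) : Type := Fin m → Circle

/-- The model with corners of the torus `T^m` as a product of one-dimensional manifolds. -/
abbrev torusModel (m : ℕ) :
    ModelWithCorners ℝ (Fin m → EuclideanSpace ℝ (Fin 1))
      (ModelPi fun _ : Fin m => EuclideanSpace ℝ (Fin 1)) :=
  ModelWithCorners.pi fun _ : Fin m => 𝓡 1

end LcK

end

noncomputable section

/-! Through the exponential map, the Lie algebra ℝ^m of the torus acts on M as a vector group; its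
generators are the fundamental fields, and they commute.

Isotropy. Where θ = dφ, the form e^{-φ}Ω is closed, and Ω(X,·) = dh - hθ becomes e^{-φ}Ω(X,·) =
d(e^{-φ}h): a twisted Hamiltonian field is locally Hamiltonian in the ordinary sense. A closed
2-form is locally constant on two commuting Hamiltonian fields (`hasFDerivAt_hamiltonian_pair`), so
Ω(X,Y) = K e^φ locally (`exists_pairing_eq_const_mul_exp`). Hence the zero set of Ω(X,Y) is open and
closed. Were it empty, log |Ω(X,Y)| would be a global potential of θ, against strictness; so Ω(X,Y)
vanishes identically (`pairing_eq_zero`).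

Dimension. On an isotropic subspace V, JV is g-orthogonal to V, so vectors of V independent over ℝ
are independent over ℂ, and there are at most n of them. It remains to find a point where the m
generators are independent over ℝ (`IsSmoothFlow.exists_linearIndependent`). If one generator were,
near a point, a real combination of others independent there, its coefficients would be holomorphic
and real, hence constant. A fixed nonzero element of the Lie algebra would then generate a field
vanishing on an open set, hence everywhere, and its one-parameter group would act trivially, against
effectiveness. -/

namespace LcK

open Filter Topology

/-! ### Hamiltonian fields and commuting velocity fields in a normed space. -/

section Calculus

variable {E : Type*} [NormedAddCommGroup E] [NormedSpace ℝ E]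
  {V : Type*} [NormedAddCommGroup V] [NormedSpace ℝ V]

/-- The derivative of the evaluation of a `2`-form on two vector fields. -/
theorem hasFDerivAt_twoForm_apply {η₀ : E → E [⋀^Fin 2]→L[ℝ] ℝ} {p : E}
    (hω : DifferentiableAt ℝ η₀ p) {X Y : E → E} (hX : DifferentiableAt ℝ X p)
    (hY : DifferentiableAt ℝ Y p) :
    DifferentiableAt ℝ (fun z => η₀ z ![X z, Y z]) p ∧
      ∀ u, fderiv ℝ (fun z => η₀ z ![X z, Y z]) p u =
        fderiv ℝ η₀ p u ![X p, Y p] + η₀ p ![fderiv ℝ X p u, Y p] +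
          η₀ p ![X p, fderiv ℝ Y p u] := by
  have hg : ∀ i : Fin 2, DifferentiableAt ℝ ((![X, Y] : Fin 2 → E → E) i) p := by
    intro i
    fin_cases i
    · exact hX
    · exact hY
  have e : (fun z => η₀ z ![X z, Y z]) =
      fun z => η₀ z (fun i => (![X, Y] : Fin 2 → E → E) i z) := by
    funext z
    congr 1
    funext i
    fin_cases i <;> rfl
  have e' : (fun i => (![X, Y] : Fin 2 → E → E) i p) = ![X p, Y p] := by
    funext i
    fin_cases i <;> rfl
  rw [e]
  refine ⟨hω.continuousAlternatingMap_apply hg, fun u => ?_⟩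
  rw [fderiv_continuousAlternatingMap_apply_apply hω hg, e', Fin.sum_univ_two]
  have h0 : Function.update ![X p, Y p] 0 (fderiv ℝ X p u) = ![fderiv ℝ X p u, Y p] := by
    funext i
    fin_cases i <;> rfl
  have h1 : Function.update ![X p, Y p] 1 (fderiv ℝ Y p u) = ![X p, fderiv ℝ Y p u] := by
    funext i
    fin_cases i <;> rfl
  simp only [Matrix.cons_val_zero, Matrix.cons_val_one, h0, h1, add_assoc]

theorem twoForm_swap (η : E [⋀^Fin 2]→L[ℝ] ℝ) (v w : E) : η ![v, w] = -η ![w, v] := by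
  have h := η.map_swap ![w, v] (i := 0) (j := 1) (by decide)
  refine Eq.trans ?_ h
  change η _ = η _
  congr 1
  funext i
  fin_cases i <;> rfl

/-- For constant vectors the bracket terms of the invariant formula are absent; what remains is the
alternating sum over the entry used as direction of differentiation. -/
theorem extDeriv_twoForm_apply {η₀ : E → E [⋀^Fin 2]→L[ℝ] ℝ} {p : E} (u v w : E) :
    extDeriv η₀ p ![u, v, w] = fderiv ℝ η₀ p u ![v, w] - fderiv ℝ η₀ p v ![u, w] +
      fderiv ℝ η₀ p w ![u, v] := by
  rw [extDeriv, ContinuousAlternatingMap.alternatizeUncurryFin_apply, Fin.sum_univ_three]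
  have h0 : (0 : Fin 3).removeNth ![u, v, w] = ![v, w] := by
    funext i
    fin_cases i <;> rfl
  have h1 : (1 : Fin 3).removeNth ![u, v, w] = ![u, w] := by
    funext i
    fin_cases i <;> rfl
  have h2 : (2 : Fin 3).removeNth ![u, v, w] = ![u, v] := by
    funext i
    fin_cases i <;> rfl
  rw [h0, h1, h2]
  simp [sub_eq_add_neg]

/-- If `X` is the Hamiltonian vector field of `F`, differentiating the relation gives an expression
symmetric in both arguments. -/
theorem hamiltonian_fderiv_symm {η₀ : E → E [⋀^Fin 2]→L[ℝ] ℝ} {p : E}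
    (hω : DifferentiableAt ℝ η₀ p) {X : E → E} (hX : DifferentiableAt ℝ X p) {F : E → ℝ}
    (hF : ContDiffAt ℝ 2 F p) (hFX : ∀ᶠ z in 𝓝 p, ∀ v, η₀ z ![X z, v] = fderiv ℝ F z v) (u v : E) :
    fderiv ℝ η₀ p u ![X p, v] + η₀ p ![fderiv ℝ X p u, v] =
      fderiv ℝ η₀ p v ![X p, u] + η₀ p ![fderiv ℝ X p v, u] := by
  -- Differentiating η(X, v) = dF(v) along u, with v held constant, gives the second derivative of
  -- F, which is symmetric.
  have key : ∀ u v : E, fderiv ℝ η₀ p u ![X p, v] + η₀ p ![fderiv ℝ X p u, v] =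
      fderiv ℝ (fderiv ℝ F) p u v := by
    intro u v
    have h1 := (hasFDerivAt_twoForm_apply hω hX (differentiableAt_const v)).2 u
    have hd : DifferentiableAt ℝ (fderiv ℝ F) p :=
      (hF.fderiv_right (m := 1) (by norm_num)).differentiableAt (by norm_num)
    have h2 : fderiv ℝ (fun z => η₀ z ![X z, v]) p u = fderiv ℝ (fun z => fderiv ℝ F z v) p u := by
      rw [EventuallyEq.fderiv_eq]
      filter_upwards [hFX] with z hz using hz v
    rw [h2, fderiv_clm_apply hd (differentiableAt_const v)] at h1
    have h3 : η₀ p ![X p, 0] = 0 := (η₀ p).map_coord_zero (1 : Fin 2) rfl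
    simpa [h3] using h1.symm
  rw [key, key]
  exact (hF.isSymmSndFDerivAt (by simp)) u v

/-- For a closed `2`-form, the form evaluated on two commuting Hamiltonian vector fields has
vanishing differential. -/
theorem hasFDerivAt_hamiltonian_pair {η₀ : E → E [⋀^Fin 2]→L[ℝ] ℝ} {p : E}
    (hω : DifferentiableAt ℝ η₀ p) (hd : extDeriv η₀ p = 0) {X Y : E → E}
    (hX : DifferentiableAt ℝ X p) (hY : DifferentiableAt ℝ Y p) {F G : E → ℝ}
    (hF : ContDiffAt ℝ 2 F p) (hG : ContDiffAt ℝ 2 G p)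
    (hFX : ∀ᶠ z in 𝓝 p, ∀ v, η₀ z ![X z, v] = fderiv ℝ F z v)
    (hGY : ∀ᶠ z in 𝓝 p, ∀ v, η₀ z ![Y z, v] = fderiv ℝ G z v)
    (hcomm : fderiv ℝ X p (Y p) = fderiv ℝ Y p (X p)) :
    HasFDerivAt (fun z => η₀ z ![X z, Y z]) (0 : E →L[ℝ] ℝ) p := by
  obtain ⟨h1, h2⟩ := hasFDerivAt_twoForm_apply hω hX hY
  have : fderiv ℝ (fun z => η₀ z ![X z, Y z]) p = 0 := by
    ext u
    -- By `a` and `b`, the derivative along u of η(X,Y) equals -dη(X,Y,u) + η(D_Y X - D_X Y, u);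
    -- closedness kills the first term, commutation the second.
    have a := hamiltonian_fderiv_symm hω hX hF hFX u (Y p)
    have b := hamiltonian_fderiv_symm hω hY hG hGY u (X p)
    have c := extDeriv_twoForm_apply (η₀ := η₀) (p := p) (X p) (Y p) u
    rw [hd] at c
    rw [h2, twoForm_swap (η₀ p) (X p)]
    rw [twoForm_swap (fderiv ℝ η₀ p u) (Y p)] at b
    rw [hcomm] at a
    change (0 : ℝ) = _ at c
    rw [_root_.zero_apply]
    linarith
  rw [← this]
  exact h1.hasFDerivAt

/-- The velocity field of the local flow `A` in the direction `τ`. -/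
def velocity (A : V × E → E) (τ : V) (z : E) : E := fderiv ℝ A (0, z) (τ, 0)

/-- Turns derivatives of generators into mixed second derivatives of A, so that symmetry of the
second derivative can exchange time and space. -/
theorem hasFDerivAt_velocity {A : V × E → E} {p : E} (hA : ContDiffAt ℝ 2 A (0, p)) (τ : V) :
    DifferentiableAt ℝ (velocity A τ) p ∧
      ∀ u, fderiv ℝ (velocity A τ) p u = fderiv ℝ (fderiv ℝ A) (0, p) (0, u) (τ, 0) := by
  have hd : DifferentiableAt ℝ (fderiv ℝ A) (0, p) :=
    (hA.fderiv_right (m := 1) (by norm_num)).differentiableAt (by norm_num)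
  have h1 : HasFDerivAt (fun z : E => ((0 : V), z)) (ContinuousLinearMap.inr ℝ V E) p :=
    hasFDerivAt_prodMk_right 0 p
  have h2 := (hd.hasFDerivAt.comp p h1).clm_apply (hasFDerivAt_const ((τ, 0) : V × E) p)
  refine ⟨h2.differentiableAt, fun u => ?_⟩
  have h3 : fderiv ℝ (velocity A τ) p = _ := h2.fderiv
  rw [h3]
  simp

/-- The velocity fields of a local action of a vector group commute. -/
theorem fderiv_velocity_comm {A : V × E → E} {p : E} (hA : ContDiffAt ℝ 2 A (0, p))
    (h0 : A (0, p) = p)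
    (hadd : ∀ᶠ q : V × V × E in 𝓝 (0, 0, p), A (q.1, A q.2) = A (q.1 + q.2.1, q.2.2))
    (σ τ : V) :
    fderiv ℝ (velocity A σ) p (velocity A τ p) = fderiv ℝ (velocity A τ) p (velocity A σ p) := by
  -- Obtained from A(s, A(t, p)) = A(s + t, p) by differentiating in s at 0 and then in t at 0; the
  -- right-hand side is symmetric in σ and τ.
  have key : ∀ σ τ : V, fderiv ℝ (velocity A σ) p (velocity A τ p) =
      fderiv ℝ (fderiv ℝ A) (0, p) (τ, 0) (σ, 0) := by
    intro σ τ
    have hd : DifferentiableAt ℝ (fderiv ℝ A) (0, p) :=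
      (hA.fderiv_right (m := 1) (by norm_num)).differentiableAt (by norm_num)
    have hA1 : ∀ᶠ q in 𝓝 ((0 : V), p), DifferentiableAt ℝ A q := by
      filter_upwards [hA.eventually (by simp)] with q hq using hq.differentiableAt (by norm_num)
    have hA2 : ∀ᶠ q in 𝓝 ((0 : V), p), DifferentiableAt ℝ A (0, A q) := by
      have hc : ContinuousAt (fun q : V × E => ((0 : V), A q)) (0, p) :=
        continuousAt_const.prodMk hA.continuousAt
      have := hc.tendsto
      simp only [h0] at this
      exact this.eventually hA1
    -- differentiating in the first time variable
    have h1 : ∀ᶠ q in 𝓝 ((0 : V), p), velocity A σ (A q) = fderiv ℝ A q (σ, 0) := by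
      have hev := hadd.eventually_nhds
      have hc : Tendsto (fun q : V × E => ((0 : V), q)) (𝓝 (0, p)) (𝓝 (0, 0, p)) :=
        (by fun_prop : Continuous (fun q : V × E => ((0 : V), q))).tendsto _
      filter_upwards [hc.eventually hev, hA1, hA2] with q hq hq1 hq2
      have hs : ∀ᶠ s in 𝓝 (0 : V), A (s, A q) = A (s + q.1, q.2) := by
        have hc' : Tendsto (fun s : V => (s, q)) (𝓝 0) (𝓝 ((0 : V), q)) :=
          (by fun_prop : Continuous (fun s : V => (s, q))).tendsto _
        exact hc'.eventually hq
      have d1 : HasFDerivAt (fun s : V => A (s, A q))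
          ((fderiv ℝ A (0, A q)).comp (ContinuousLinearMap.inl ℝ V E)) 0 :=
        HasFDerivAt.comp (0 : V) (g := A) (f := fun s : V => (s, A q)) hq2.hasFDerivAt
          (hasFDerivAt_prodMk_left 0 (A q))
      have d2 : HasFDerivAt (fun s : V => A (s + q.1, q.2))
          ((fderiv ℝ A q).comp (ContinuousLinearMap.inl ℝ V E)) 0 := by
        have hi : HasFDerivAt (fun s : V => (s + q.1, q.2)) (ContinuousLinearMap.inl ℝ V E) 0 :=
          HasFDerivAt.prodMk ((hasFDerivAt_id (0 : V)).add_const q.1)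
            (hasFDerivAt_const q.2 (0 : V))
        refine HasFDerivAt.comp (0 : V) (g := A) (f := fun s : V => (s + q.1, q.2)) ?_ hi
        simpa using hq1.hasFDerivAt
      have := (d1.congr_of_eventuallyEq (EventuallyEq.symm hs)).unique d2
      have := congrArg (fun T : V →L[ℝ] E => T σ) this
      simpa [velocity] using this
    -- differentiating in the second time variable
    have h2 : ∀ᶠ t in 𝓝 (0 : V), velocity A σ (A (t, p)) = fderiv ℝ A (t, p) (σ, 0) := by
      have hc' : Tendsto (fun t : V => (t, p)) (𝓝 0) (𝓝 ((0 : V), p)) :=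
        (by fun_prop : Continuous (fun t : V => (t, p))).tendsto _
      exact hc'.eventually h1
    have di : HasFDerivAt (fun t : V => (t, p)) (ContinuousLinearMap.inl ℝ V E) 0 :=
      hasFDerivAt_prodMk_left 0 p
    have d1 : HasFDerivAt (fun t : V => A (t, p))
        ((fderiv ℝ A (0, p)).comp (ContinuousLinearMap.inl ℝ V E)) 0 :=
      HasFDerivAt.comp (0 : V) (g := A) (f := fun t : V => (t, p))
        hA1.self_of_nhds.hasFDerivAt di
    have d2 : HasFDerivAt (fun t : V => velocity A σ (A (t, p)))
        ((fderiv ℝ (velocity A σ) p).comp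
          ((fderiv ℝ A (0, p)).comp (ContinuousLinearMap.inl ℝ V E))) 0 := by
      refine HasFDerivAt.comp (0 : V) (g := velocity A σ) (f := fun t : V => A (t, p)) ?_ d1
      rw [h0]
      exact (hasFDerivAt_velocity hA σ).1.hasFDerivAt
    have d3 : HasFDerivAt (fun t : V => fderiv ℝ A (t, p) (σ, 0)) _ 0 :=
      (HasFDerivAt.comp (0 : V) (g := fderiv ℝ A) (f := fun t : V => (t, p))
        hd.hasFDerivAt di).clm_apply (hasFDerivAt_const ((σ, 0) : V × E) (0 : V))
    have := (d2.congr_of_eventuallyEq (EventuallyEq.symm h2)).unique d3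
    have := congrArg (fun T : V →L[ℝ] E => T τ) this
    simpa [velocity] using this
  rw [key, key]
  exact (hA.isSymmSndFDerivAt (by simp)) _ _

end Calculus

/-! ### Holomorphic velocity fields, constancy of real coefficients, identity theorem. -/

section Complex

variable {E : Type*} [NormedAddCommGroup E] [NormedSpace ℂ E]
  {V : Type*} [NormedAddCommGroup V] [NormedSpace ℝ V]

/-- The velocity fields of a local action by holomorphic maps are holomorphic. -/
theorem differentiableAt_velocity {A : V × E → E} {p : E} (hA : ContDiffAt ℝ 2 A (0, p))
    (hhol : ∀ᶠ t in 𝓝 (0 : V), DifferentiableAt ℂ (fun z => A (t, z)) p) (τ : V) :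
    DifferentiableAt ℂ (velocity A τ) p := by
  obtain ⟨h1, h2⟩ := hasFDerivAt_velocity hA τ
  have hd : DifferentiableAt ℝ (fderiv ℝ A) (0, p) :=
    (hA.fderiv_right (m := 1) (by norm_num)).differentiableAt (by norm_num)
  have hsymm := hA.isSymmSndFDerivAt (by simp)
  have hc' : Tendsto (fun t : V => (t, p)) (𝓝 0) (𝓝 ((0 : V), p)) :=
    (by fun_prop : Continuous (fun t : V => (t, p))).tendsto _
  have hA1 : ∀ᶠ q in 𝓝 ((0 : V), p), DifferentiableAt ℝ A q := by
    filter_upwards [hA.eventually (by simp)] with q hq using hq.differentiableAt (by norm_num)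
  have hlin : ∀ u : E, ∀ᶠ t in 𝓝 (0 : V),
      fderiv ℝ A (t, p) (0, Complex.I • u) = Complex.I • fderiv ℝ A (t, p) (0, u) := by
    intro u
    filter_upwards [hhol, hc'.eventually hA1] with t ht ht1
    have d1 : HasFDerivAt (fun z : E => A (t, z))
        ((fderiv ℝ A (t, p)).comp (ContinuousLinearMap.inr ℝ V E)) p :=
      HasFDerivAt.comp p (g := A) (f := fun z : E => (t, z)) ht1.hasFDerivAt
        (hasFDerivAt_prodMk_right t p)
    have e := d1.unique (ht.hasFDerivAt.restrictScalars ℝ)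
    have e1 := fun w => congrArg (fun T : E →L[ℝ] E => T w) e
    simp only [ContinuousLinearMap.comp_apply, ContinuousLinearMap.inr_apply,
      ContinuousLinearMap.coe_restrictScalars'] at e1
    rw [e1, e1, map_smul]
  have di : HasFDerivAt (fun t : V => (t, p)) (ContinuousLinearMap.inl ℝ V E) 0 :=
    hasFDerivAt_prodMk_left 0 p
  have d3 : ∀ w : E, HasFDerivAt (fun t : V => fderiv ℝ A (t, p) (0, w)) _ 0 := fun w =>
    (HasFDerivAt.comp (0 : V) (g := fderiv ℝ A) (f := fun t : V => (t, p))
      hd.hasFDerivAt di).clm_apply (hasFDerivAt_const ((0, w) : V × E) (0 : V))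
  -- The space derivative of A(t,·) commutes with i for small t; differentiate this in t at 0 and
  -- swap the two derivatives.
  have hI : ∀ u : E, fderiv ℝ (velocity A τ) p (Complex.I • u) =
      Complex.I • fderiv ℝ (velocity A τ) p u := by
    intro u
    rw [h2, h2, hsymm, hsymm (0, u)]
    have d4 := (d3 u).const_smul Complex.I
    have e := ((d3 (Complex.I • u)).congr_of_eventuallyEq
      (EventuallyEq.symm (hlin u))).unique d4
    have e1 := congrArg (fun T : V →L[ℝ] E => T τ) e
    simpa using e1
  rw [differentiableAt_iff_restrictScalars ℝ h1]
  refine ⟨{ toFun := fderiv ℝ (velocity A τ) p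
            map_add' := map_add _
            map_smul' := fun c u => ?_
            cont := (fderiv ℝ (velocity A τ) p).cont }, rfl⟩
  have hr : ∀ (r : ℝ) (v : E), fderiv ℝ (velocity A τ) p ((r : ℂ) • v) =
      (r : ℂ) • fderiv ℝ (velocity A τ) p v := fun r v => by
    rw [Complex.coe_smul, Complex.coe_smul, map_smul]
  rw [← Complex.re_add_im c]
  simp only [add_smul, mul_smul, map_add, hr, hI, RingHom.id_apply]

/-- A holomorphic function with real values is locally constant. -/
theorem eventually_eq_of_differentiableAt_of_im_eq_zero {f : E → ℂ} {p : E}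
    (hf : ∀ᶠ z in 𝓝 p, DifferentiableAt ℂ f z) (him : ∀ᶠ z in 𝓝 p, (f z).im = 0) :
    ∀ᶠ z in 𝓝 p, f z = f p := by
  obtain ⟨r, hr, hb⟩ := Metric.eventually_nhds_iff_ball.1 (hf.and him)
  filter_upwards [Metric.ball_mem_nhds p hr] with z hz
  refine (Metric.isOpen_ball (x := p) (ε := r)).is_const_of_fderiv_eq_zero (𝕜 := ℂ)
    (convex_ball p r).isPreconnected (fun w hw => (hb w hw).1.differentiableWithinAt) ?_ hz
    (Metric.mem_ball_self hr)
  intro w hw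
  have d := (hb w hw).1.hasFDerivAt
  have d1 : HasFDerivAt (fun z => (f z).im) _ w :=
    Complex.imCLM.hasFDerivAt.comp w (d.restrictScalars ℝ)
  have hz : (fun z => (f z).im) =ᶠ[𝓝 w] fun _ => 0 := by
    filter_upwards [Metric.isOpen_ball.mem_nhds hw] with y hy using (hb y hy).2
  have e := d1.unique ((hasFDerivAt_const (0 : ℝ) w).congr_of_eventuallyEq hz)
  have him0 : ∀ u, (fderiv ℂ f w u).im = 0 := fun u => by
    simpa using congrArg (fun T : E →L[ℝ] ℝ => T u) e
  ext u
  apply Complex.ext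
  -- The real part of a complex number a is the imaginary part of i a.
  · have := him0 (Complex.I • u)
    rw [map_smul] at this
    simpa using this
  · simpa using him0 u

/-- If the holomorphic map `Y` is a real combination of the holomorphic maps `X i`, linearly
independent over `ℂ` at `p`, the coefficients are locally constant. -/
theorem exists_const_coeff [FiniteDimensional ℂ E] {k : ℕ} {X : Fin k → E → E} {Y : E → E} {p : E}
    (hX : ∀ i, ∀ᶠ z in 𝓝 p, DifferentiableAt ℂ (X i) z)
    (hY : ∀ᶠ z in 𝓝 p, DifferentiableAt ℂ Y z)
    (hli : LinearIndependent ℂ fun i => X i p)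
    (hspan : ∀ᶠ z in 𝓝 p, ∃ c : Fin k → ℝ, Y z = ∑ i, c i • X i z) :
    ∃ c : Fin k → ℝ, ∀ᶠ z in 𝓝 p, Y z = ∑ i, c i • X i z := by
  let T : E → (Fin k → ℂ) →L[ℂ] E := fun z =>
    ∑ i, (ContinuousLinearMap.proj i : (Fin k → ℂ) →L[ℂ] ℂ).smulRight (X i z)
  have hT : ∀ z c, T z c = ∑ i, c i • X i z := fun z c => by simp [T]
  have hker : LinearMap.ker (T p : (Fin k → ℂ) →ₗ[ℂ] E) = ⊥ := by
    rw [LinearMap.ker_eq_bot']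
    intro c hc
    funext i
    exact Fintype.linearIndependent_iff.1 hli c ((hT p c).symm.trans hc) i
  -- A left inverse is needed at p only: L ∘ T z stays invertible for z near p, so (L ∘ T z)⁻¹ L (Y
  -- z) recovers the coefficients and depends holomorphically on z.
  obtain ⟨L', hL'⟩ := LinearMap.exists_leftInverse_of_injective _ hker
  let L : E →L[ℂ] (Fin k → ℂ) := LinearMap.toContinuousLinearMap L'
  have hL : L.comp (T p) = 1 := by
    ext1 c
    exact congrArg (fun g : (Fin k → ℂ) →ₗ[ℂ] (Fin k → ℂ) => g c) hL'
  have hTd : ∀ᶠ z in 𝓝 p, DifferentiableAt ℂ (fun z => L.comp (T z)) z := by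
    filter_upwards [eventually_all.2 hX] with z hz
    have h1 : DifferentiableAt ℂ T z := by
      apply DifferentiableAt.fun_sum
      intro i _
      exact ((ContinuousLinearMap.smulRightL ℂ (Fin k → ℂ) E
        (ContinuousLinearMap.proj i)).differentiableAt).comp z (hz i)
    exact (differentiableAt_const L).clm_comp h1
  have hu : ∀ᶠ z in 𝓝 p, IsUnit (L.comp (T z)) := by
    have hc : ContinuousAt (fun z => L.comp (T z)) p := hTd.self_of_nhds.continuousAt
    refine hc.eventually (Units.isOpen.mem_nhds ?_)
    simp only [hL]
    exact isUnit_one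
  let f : E → Fin k → ℂ := fun z => Ring.inverse (L.comp (T z)) (L (Y z))
  have hfd : ∀ᶠ z in 𝓝 p, DifferentiableAt ℂ f z := by
    filter_upwards [hTd, hY, hu] with z h1 h2 h3
    have hinv : DifferentiableAt ℂ (fun z => Ring.inverse (L.comp (T z))) z := by
      obtain ⟨w, hw⟩ := h3
      have hd := differentiableAt_inverse (𝕜 := ℂ) w.isUnit
      rw [hw] at hd
      exact hd.comp z h1
    exact hinv.clm_apply (L.differentiableAt.comp z h2)
  have hfs : ∀ᶠ z in 𝓝 p, ∃ c : Fin k → ℝ, Y z = ∑ i, c i • X i z ∧ f z = fun i => (c i : ℂ) := by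
    filter_upwards [hspan, hu] with z ⟨c, hc⟩ h3
    refine ⟨c, hc, ?_⟩
    have : Y z = T z (fun i => (c i : ℂ)) := by
      rw [hT, hc]
      simp only [Complex.coe_smul]
    simp only [f, this]
    exact congrArg (fun g : (Fin k → ℂ) →L[ℂ] (Fin k → ℂ) => g fun i => (c i : ℂ))
      (Ring.inverse_mul_cancel _ h3)
  have hconst : ∀ i, ∀ᶠ z in 𝓝 p, f z i = f p i := fun i => by
    refine eventually_eq_of_differentiableAt_of_im_eq_zero (f := fun z => f z i) ?_ ?_
    · filter_upwards [hfd] with z hz using differentiableAt_pi.1 hz i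
    · filter_upwards [hfs] with z ⟨c, _, hc⟩
      rw [hc]
      exact Complex.ofReal_im _
  obtain ⟨c0, _, hc0⟩ := hfs.self_of_nhds
  refine ⟨c0, ?_⟩
  filter_upwards [hfs, eventually_all.2 hconst] with z ⟨c, hc, hfc⟩ hz
  have : c = c0 := by
    funext i
    have := hz i
    rw [hfc, hc0] at this
    exact Complex.ofReal_injective this
  rw [hc, this]

/-- The identity theorem for holomorphic maps on a ball. -/
theorem eqOn_zero_ball {f : E → E} [CompleteSpace E] {p q : E} {r : ℝ}
    (hf : DifferentiableOn ℂ f (Metric.ball p r)) (hq : q ∈ Metric.ball p r)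
    (h0 : ∀ᶠ z in 𝓝 q, f z = 0) {z : E} (hz : z ∈ Metric.ball p r) : f z = 0 := by
  -- Restriction to the complex line through q and z reduces to the one-variable identity theorem;
  -- the line meets the ball in a convex set.
  let l : ℂ → E := fun t => q + t • (z - q)
  have hl : Continuous l := by fun_prop
  have hld : Differentiable ℂ l := by
    intro t
    exact (differentiableAt_id.smul_const (z - q)).const_add q
  let W : Set ℂ := l ⁻¹' Metric.ball p r
  have hWo : IsOpen W := Metric.isOpen_ball.preimage hl
  have hWc : IsPreconnected W := by
    apply Convex.isPreconnected
    intro s hs t ht a b ha hb hab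
    have : l (a • s + b • t) = a • l s + b • l t := by
      simp only [l, smul_add, add_smul, smul_assoc]
      have : q = a • q + b • q := by rw [← add_smul, hab, one_smul]
      nth_rw 1 [this]
      abel
    change l _ ∈ Metric.ball p r
    rw [this]
    exact convex_ball p r hs ht ha hb hab
  have hfl : DifferentiableOn ℂ (f ∘ l) W :=
    hf.comp hld.differentiableOn (fun t ht => ht)
  have h0' : (f ∘ l) =ᶠ[𝓝 (0 : ℂ)] 0 := by
    have : Tendsto l (𝓝 0) (𝓝 q) := by
      have := hl.tendsto 0
      simpa [l] using this
    exact this.eventually h0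
  have := (hfl.analyticOnNhd hWo).eqOn_zero_of_preconnected_of_eventuallyEq_zero hWc
    (show (0 : ℂ) ∈ W by simpa [W, l] using hq) h0'
    (show (1 : ℂ) ∈ W by simpa [W, l] using hz)
  simpa [l] using this

end Complex

/-! ### Differentiability of form-valued maps. -/

section Alternating

variable {E E' F : Type*} [NormedAddCommGroup E] [NormedSpace ℝ E] [FiniteDimensional ℝ E]
  [NormedAddCommGroup F] [NormedSpace ℝ F] [FiniteDimensional ℝ F]
  [NormedAddCommGroup E'] [NormedSpace ℝ E']

/-- On a finite-dimensional space, a form-valued map is differentiable as soon as its evaluations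
are. -/
theorem differentiableAt_alternating_of_apply {k : ℕ} {f : E' → E [⋀^Fin k]→L[ℝ] F} {p : E'}
    (h : ∀ v : Fin k → E, DifferentiableAt ℝ (fun z => f z v) p) : DifferentiableAt ℝ f p := by
  classical
  let b := Module.finBasis ℝ E
  -- A form is recovered linearly from its finitely many values on tuples of basis vectors.
  let Φ : (E [⋀^Fin k]→L[ℝ] F) →ₗ[ℝ] ((Fin k → Fin (Module.finrank ℝ E)) → F) :=
    { toFun := fun η s => η fun i => b (s i)
      map_add' := fun _ _ => rfl
      map_smul' := fun _ _ => rfl }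
  have hinj : LinearMap.ker Φ = ⊥ := by
    rw [LinearMap.ker_eq_bot]
    intro η η' hh
    apply ContinuousAlternatingMap.toAlternatingMap_injective
    exact Module.Basis.ext_alternating b fun v _ => congrFun hh v
  obtain ⟨L, hL⟩ := LinearMap.exists_leftInverse_of_injective Φ hinj
  have e : f = (LinearMap.toContinuousLinearMap L) ∘ (fun z => Φ (f z)) := by
    funext z
    exact (congrArg (fun g : _ →ₗ[ℝ] _ => g (f z)) hL).symm
  rw [e]
  refine (LinearMap.toContinuousLinearMap L).differentiableAt.comp p ?_
  exact differentiableAt_pi.2 fun s => h _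

end Alternating

/-! ### Metrics, functions and forms in charts. -/

section RealManifold

variable {E : Type*} [NormedAddCommGroup E] [NormedSpace ℝ E]
  {M : Type*} [TopologicalSpace M] [ChartedSpace E M] [IsManifold 𝓘(ℝ, E) ∞ M]

/-- The coordinate vector fields of a chart are smooth. -/
theorem contMDiffAt_coordField (c : M) (v : E) {z : E} (hz : z ∈ (chartAt E c).target) :
    ContMDiffAt 𝓘(ℝ, E) (𝓘(ℝ, E).prod 𝓘(ℝ, E)) ∞
      (fun z : E => Bundle.TotalSpace.mk' E
        (E := fun x : M => TangentSpace 𝓘(ℝ, E) x) ((chartAt E c).symm z)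
        (mfderiv 𝓘(ℝ, E) 𝓘(ℝ, E) (chartAt E c).symm z v)) z := by
  have ho := (chartAt E c).open_target
  have h1 := (contMDiffOn_chart_symm (I := 𝓘(ℝ, E)) (x := c)
    (n := ∞)).contMDiffOn_tangentMapWithin (m := ∞) (by simp) ho.uniqueMDiffOn
  have h2 : ContMDiff 𝓘(ℝ, E) (𝓘(ℝ, E).prod 𝓘(ℝ, E)) ∞
      (fun z : E => (⟨z, v⟩ : TangentBundle 𝓘(ℝ, E) E)) := by
    refine (contMDiff_vectorSpace_iff_contDiff (V := fun _ : E => v)).2 ?_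
    exact contDiff_const
  have h3 := (ContMDiffOn.comp (s := (chartAt E c).target) h1 h2.contMDiffOn
    (fun z hz => hz)).contMDiffAt (ho.mem_nhds hz)
  refine h3.congr_of_eventuallyEq ?_
  filter_upwards [ho.mem_nhds hz] with y hy
  simp only [Function.comp_apply, tangentMapWithin]
  rw [mfderivWithin_of_mem_nhds (ho.mem_nhds hy)]

theorem differentiableAt_metric_coord
    (g : Bundle.ContMDiffRiemannianMetric 𝓘(ℝ, E) ∞ E (fun x : M => TangentSpace 𝓘(ℝ, E) x))
    (c : M) (v w : E) {z : E} (hz : z ∈ (chartAt E c).target) :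
    DifferentiableAt ℝ (fun z => g.inner ((chartAt E c).symm z)
      (mfderiv 𝓘(ℝ, E) 𝓘(ℝ, E) (chartAt E c).symm z v)
      (mfderiv 𝓘(ℝ, E) 𝓘(ℝ, E) (chartAt E c).symm z w)) z := by
  have hsymm := (contMDiffOn_chart_symm (I := 𝓘(ℝ, E)) (x := c) (n := ∞)).contMDiffAt
    ((chartAt E c).open_target.mem_nhds hz)
  have h := ContMDiffAt.clm_bundle_apply₂ (F₁ := E) (F₂ := E) (F₃ := ℝ)
    (E₁ := fun x : M => TangentSpace 𝓘(ℝ, E) x)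
    (E₂ := fun x : M => TangentSpace 𝓘(ℝ, E) x) (E₃ := Bundle.Trivial M ℝ)
    ((g.contMDiff _).comp z hsymm)
    (contMDiffAt_coordField c v hz) (contMDiffAt_coordField c w hz)
  rw [Bundle.contMDiffAt_totalSpace] at h
  exact h.2.contDiffAt.differentiableAt (by simp)

/-- A smooth function is smooth in coordinates. -/
theorem contDiffAt_comp_chart_symm {f : M → ℝ} {c : M} {z : E} (hz : z ∈ (chartAt E c).target)
    (hf : ContMDiffAt 𝓘(ℝ, E) 𝓘(ℝ, ℝ) ∞ f ((chartAt E c).symm z)) :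
    ContDiffAt ℝ ∞ (fun z => f ((chartAt E c).symm z)) z :=
  (hf.comp z ((contMDiffOn_chart_symm (I := 𝓘(ℝ, E)) (x := c) (n := ∞)).contMDiffAt
    ((chartAt E c).open_target.mem_nhds hz))).contDiffAt

/-- A function with vanishing differential near a point is locally constant there. -/
theorem eventually_eq_of_hasMFDerivAt_zero {k : M → ℝ} {c : M} {U : Set M} (hU : IsOpen U)
    (hc : c ∈ U) (hk : ∀ y ∈ U, HasMFDerivAt 𝓘(ℝ, E) 𝓘(ℝ, ℝ) k y 0) :
    ∀ᶠ y in 𝓝 c, k y = k c := by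
  let e := chartAt E c
  have hcs : c ∈ e.source := mem_chart_source E c
  have hW : IsOpen (e.target ∩ e.symm ⁻¹' U) := e.isOpen_inter_preimage_symm hU
  have hcW : e c ∈ e.target ∩ e.symm ⁻¹' U := by
    refine ⟨e.map_source hcs, ?_⟩
    rw [Set.mem_preimage, e.left_inv hcs]
    exact hc
  obtain ⟨r, hr, hb⟩ := Metric.isOpen_iff.1 hW _ hcW
  have hconst : ∀ z ∈ Metric.ball (e c) r, k (e.symm z) = k c := by
    intro z hz
    have hd : ∀ w ∈ Metric.ball (e c) r, HasFDerivAt (fun w => k (e.symm w)) (0 : E →L[ℝ] ℝ) w := by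
      intro w hw
      have h1 := (mdifferentiableAt_atlas_symm (I := 𝓘(ℝ, E))
        (chart_mem_atlas E c) (hb hw).1).hasMFDerivAt
      have h2 := HasMFDerivAt.comp w (hk _ (hb hw).2) h1
      have h3 : HasMFDerivAt 𝓘(ℝ, E) 𝓘(ℝ, ℝ) (k ∘ e.symm) w 0 := by
        convert h2 using 1
        exact (ContinuousLinearMap.zero_comp _).symm
      exact h3.hasFDerivAt
    have := (Metric.isOpen_ball (x := e c) (ε := r)).is_const_of_fderiv_eq_zero (𝕜 := ℝ)
      (convex_ball _ r).isPreconnected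
      (fun w hw => (hd w hw).differentiableAt.differentiableWithinAt)
      (fun w hw => (hd w hw).fderiv) hz (Metric.mem_ball_self hr)
    simpa [e.left_inv hcs] using this
  have : ∀ᶠ y in 𝓝 c, y ∈ e.source ∧ e y ∈ Metric.ball (e c) r :=
    (e.open_source.eventually_mem hcs).and
      ((e.continuousAt hcs).eventually (Metric.ball_mem_nhds _ hr))
  filter_upwards [this] with y hy
  rw [← hconst _ hy.2, e.left_inv hy.1]

theorem hasMFDerivAt_of_comp_chart_symm {k : M → ℝ} {c : M}
    (h : HasFDerivAt (fun z => k ((chartAt E c).symm z)) (0 : E →L[ℝ] ℝ) (chartAt E c c)) :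
    HasMFDerivAt 𝓘(ℝ, E) 𝓘(ℝ, ℝ) k c 0 := by
  have hc := mem_chart_source E c
  have h1 := (mdifferentiableAt_atlas (I := 𝓘(ℝ, E))
        (chart_mem_atlas E c) hc).hasMFDerivAt
  have h2 := HasMFDerivAt.comp c h.hasMFDerivAt h1
  have h3 : HasMFDerivAt 𝓘(ℝ, E) 𝓘(ℝ, ℝ) ((fun z => k ((chartAt E c).symm z)) ∘ chartAt E c) c 0 := by
    convert h2 using 1
    exact (ContinuousLinearMap.zero_comp _).symm
  refine h3.congr_of_eventuallyEq ?_
  filter_upwards [(chartAt E c).open_source.mem_nhds hc] with y hy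
  rw [Function.comp_apply, (chartAt E c).left_inv hy]

/-- If `dη = 0` at `x`, the exterior derivative of the expression of `η` in the chart at `x`
vanishes. -/
theorem extDeriv_inChart_eq_zero {k : ℕ} {η : Form E M k} {x : M} (h : η.d x = 0) :
    extDeriv (η.inChart x) (chartAt E x x) = 0 := by
  -- `Form.d` is a pullback by the differential of the chart; as this is onto, the form pulled back
  -- vanishes too.
  have hb := (mdifferentiable_chart (I := 𝓘(ℝ, E)) x).mfderiv_surjective (mem_chart_source E x)
  ext v
  choose w hw using fun i => hb (v i)
  have := congrArg (fun a : TangentSpace 𝓘(ℝ, E) x [⋀^Fin (k + 1)]→L[ℝ] ℝ => a w) h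
  simp only [Form.d] at this
  refine Eq.trans ?_ this
  exact congrArg (extDeriv (η.inChart x) (chartAt E x x)) (funext fun i => (hw i).symm)

end RealManifold

/-! ### Complex linearity of real derivatives of holomorphic maps. -/

section ComplexManifold

variable {E : Type*} [NormedAddCommGroup E] [NormedSpace ℂ E] [NormedSpace ℝ E]
  [IsScalarTower ℝ ℂ E]
  {E' : Type*} [NormedAddCommGroup E'] [NormedSpace ℂ E'] [NormedSpace ℝ E'] [IsScalarTower ℝ ℂ E']
  {M : Type*} [TopologicalSpace M] [ChartedSpace E M]
  {M' : Type*} [TopologicalSpace M'] [ChartedSpace E' M']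

/-- A holomorphic map is differentiable over `ℝ`, with a complex linear derivative. -/
theorem exists_hasMFDerivAt_real {f : M → M'} {x : M}
    (hf : MDifferentiableAt 𝓘(ℂ, E) 𝓘(ℂ, E') f x) :
    ∃ D : E →L[ℂ] E', HasMFDerivAt 𝓘(ℝ, E) 𝓘(ℝ, E') f x (D.restrictScalars ℝ) := by
  obtain ⟨h1, h2⟩ := hf.hasMFDerivAt
  exact ⟨_, h1, HasFDerivWithinAt.restrictScalars (E := E) (F := E') ℝ h2⟩

/-- Lets J pass through the chart, where it becomes multiplication by i. -/
theorem exists_mfderiv_chart_symm [IsManifold 𝓘(ℂ, E) 1 M] (c : M) {z : E}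
    (hz : z ∈ (chartAt E c).target) :
    ∃ D : E →L[ℂ] E, ∀ v : E, mfderiv 𝓘(ℝ, E) 𝓘(ℝ, E) (chartAt E c).symm z v = D v := by
  obtain ⟨D, hD⟩ := exists_hasMFDerivAt_real (f := (chartAt E c).symm)
    (mdifferentiableAt_atlas_symm (I := 𝓘(ℂ, E)) (chart_mem_atlas E c) hz)
  refine ⟨D, fun v => ?_⟩
  rw [hD.mfderiv]
  rfl

end ComplexManifold

/-! ### Regularity of the conformal fundamental form in a chart. -/

section Hermitian

variable {n : ℕ} {M : Type*} [TopologicalSpace M] [ChartedSpace (Model n) M]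
  [IsManifold 𝓘(ℂ, Model n) ω M]

/-- The coordinate expression of a conformal multiple of the fundamental form is differentiable. -/
theorem differentiableAt_inChart (g : HermitianMetric n M) {φ : M → ℝ} {c : M}
    (hφ : ContMDiffAt 𝓘(ℝ, Model n) 𝓘(ℝ, ℝ) ∞ φ c) :
    DifferentiableAt ℝ (Form.inChart (fun z => Real.exp (-φ z) • g.fundamentalForm z) c)
      (chartAt (Model n) c c) := by
  have hc := mem_chart_source (Model n) c
  have ht := (chartAt (Model n) c).map_source hc
  apply differentiableAt_alternating_of_apply
  intro v
  have h1 : DifferentiableAt ℝ (fun z => φ ((chartAt (Model n) c).symm z))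
      (chartAt (Model n) c c) := by
    refine (contDiffAt_comp_chart_symm ht ?_).differentiableAt (by simp)
    rwa [(chartAt (Model n) c).left_inv hc]
  refine (h1.fun_neg.exp.fun_mul (differentiableAt_metric_coord
    g.toContMDiffRiemannianMetric c (Complex.I • v 0) (v 1) ht)).congr_of_eventuallyEq ?_
  filter_upwards [(chartAt (Model n) c).open_target.mem_nhds ht] with z hz
  obtain ⟨D, hD⟩ := exists_mfderiv_chart_symm c hz
  have hJ : mfderiv 𝓘(ℝ, Model n) 𝓘(ℝ, Model n) (chartAt (Model n) c).symm z (Complex.I • v 0) =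
      complexStructure _ (mfderiv 𝓘(ℝ, Model n) 𝓘(ℝ, Model n) (chartAt (Model n) c).symm z (v 0)) := by
    rw [hD, hD]
    exact map_smul D _ _
  rw [hJ]
  rfl

end Hermitian

/-! ### Actions of vector groups and their expression in charts. -/

section Flow

variable {V : Type*} [NormedAddCommGroup V] [NormedSpace ℝ V]
  {E : Type*} [NormedAddCommGroup E] [NormedSpace ℝ E]
  {M : Type*} [TopologicalSpace M] [ChartedSpace E M]

/-- A smooth action of the additive group of a normed space on a manifold. -/
structure IsSmoothFlow (ρ : V → M → M) : Prop where
  smooth : ContMDiff (𝓘(ℝ, V).prod 𝓘(ℝ, E)) 𝓘(ℝ, E) ∞ (fun q : V × M => ρ q.1 q.2)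
  zero : ∀ x, ρ 0 x = x
  add : ∀ s t x, ρ (s + t) x = ρ s (ρ t x)

/-- The infinitesimal generator of an action of a vector group in the direction `τ`. -/
def orbitField (ρ : V → M → M) (τ : V) (x : M) : TangentSpace 𝓘(ℝ, E) x :=
  (mfderiv 𝓘(ℝ, V) 𝓘(ℝ, E) (fun t : V => ρ t x) 0 τ : E)

/-- The expression of an action in a chart. -/
def localFlow (E : Type*) [NormedAddCommGroup E] {M : Type*} [TopologicalSpace M]
    [ChartedSpace E M] (ρ : V → M → M) (c : M) (q : V × E) : E :=
  chartAt E c (ρ q.1 ((chartAt E c).symm q.2))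

variable {ρ : V → M → M}

theorem IsSmoothFlow.continuous (hρ : IsSmoothFlow (E := E) ρ) : Continuous fun q : V × M => ρ q.1 q.2 := hρ.smooth.continuous

theorem IsSmoothFlow.localFlow_zero (hρ : IsSmoothFlow (E := E) ρ) {c : M} {z : E} (hz : z ∈ (chartAt E c).target) :
    localFlow E ρ c (0, z) = z := by
  simp only [localFlow, hρ.zero]
  exact (chartAt E c).right_inv hz

theorem IsSmoothFlow.contDiffAt_localFlow (hρ : IsSmoothFlow (E := E) ρ) [IsManifold 𝓘(ℝ, E) ∞ M] {c : M} {t : V} {z : E}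
    (hz : z ∈ (chartAt E c).target)
    (ht : ρ t ((chartAt E c).symm z) ∈ (chartAt E c).source) :
    ContDiffAt ℝ ∞ (localFlow E ρ c) (t, z) := by
  have h1 : ContMDiffAt 𝓘(ℝ, V × E) 𝓘(ℝ, E) ∞ (fun q : V × E => (chartAt E c).symm q.2) (t, z) := by
    have := (contMDiffOn_chart_symm (I := 𝓘(ℝ, E)) (x := c) (n := ∞)).contMDiffAt
      ((chartAt E c).open_target.mem_nhds hz)
    exact ContMDiffAt.comp (t, z) (f := fun q : V × E => q.2) (g := (chartAt E c).symm) this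
      contDiff_snd.contMDiff.contMDiffAt
  have h2 : ContMDiffAt 𝓘(ℝ, V × E) (𝓘(ℝ, V).prod 𝓘(ℝ, E)) ∞
      (fun q : V × E => (q.1, (chartAt E c).symm q.2)) (t, z) :=
    ContMDiffAt.prodMk contDiff_fst.contMDiff.contMDiffAt h1
  have h3 : ContMDiffAt 𝓘(ℝ, V × E) 𝓘(ℝ, E) ∞
      (fun q : V × E => ρ q.1 ((chartAt E c).symm q.2)) (t, z) :=
    ContMDiffAt.comp (t, z) (f := fun q : V × E => (q.1, (chartAt E c).symm q.2))
      (g := fun q : V × M => ρ q.1 q.2) hρ.smooth.contMDiffAt h2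
  have h4 : ContMDiffAt 𝓘(ℝ, E) 𝓘(ℝ, E) ∞ (chartAt E c) (ρ t ((chartAt E c).symm z)) :=
    (contMDiffOn_chart (I := 𝓘(ℝ, E)) (x := c) (n := ∞)).contMDiffAt
      ((chartAt E c).open_source.mem_nhds ht)
  exact (ContMDiffAt.comp (t, z) (f := fun q : V × E => ρ q.1 ((chartAt E c).symm q.2))
      (g := chartAt E c) h4 h3).contDiffAt

theorem IsSmoothFlow.contDiffAt_localFlow_zero (hρ : IsSmoothFlow (E := E) ρ) [IsManifold 𝓘(ℝ, E) ∞ M] {c : M} {z : E}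
    (hz : z ∈ (chartAt E c).target) : ContDiffAt ℝ ∞ (localFlow E ρ c) (0, z) := by
  refine hρ.contDiffAt_localFlow hz ?_
  rw [hρ.zero]
  exact (chartAt E c).map_target hz

theorem IsSmoothFlow.eventually_mem_source (hρ : IsSmoothFlow (E := E) ρ) {c : M} {z : E} (hz : z ∈ (chartAt E c).target) :
    ∀ᶠ q : V × E in 𝓝 (0, z), ρ q.1 ((chartAt E c).symm q.2) ∈ (chartAt E c).source := by
  have h1 : ContinuousAt (fun q : V × E => (q.1, (chartAt E c).symm q.2)) (0, z) := by
    refine continuousAt_fst.prodMk ?_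
    exact ContinuousAt.comp (f := fun q : V × E => q.2) (g := (chartAt E c).symm)
      ((chartAt E c).continuousAt_symm hz) continuousAt_snd
  have h2 : ContinuousAt (fun q : V × E => ρ q.1 ((chartAt E c).symm q.2)) (0, z) :=
    ContinuousAt.comp (f := fun q : V × E => (q.1, (chartAt E c).symm q.2))
      (g := fun q : V × M => ρ q.1 q.2) hρ.continuous.continuousAt h1
  refine h2.eventually ((chartAt E c).open_source.mem_nhds ?_)
  simp only [hρ.zero]
  exact (chartAt E c).map_target hz

theorem IsSmoothFlow.eventually_localFlow_add (hρ : IsSmoothFlow (E := E) ρ) {c : M} {z : E} (hz : z ∈ (chartAt E c).target) :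
    ∀ᶠ q : V × V × E in 𝓝 (0, 0, z),
      localFlow E ρ c (q.1, localFlow E ρ c q.2) = localFlow E ρ c (q.1 + q.2.1, q.2.2) := by
  have hc : Tendsto (fun q : V × V × E => q.2) (𝓝 (0, 0, z)) (𝓝 (0, z)) :=
    (continuous_snd.tendsto ((0, 0, z) : V × V × E))
  filter_upwards [hc.eventually (hρ.eventually_mem_source hz)] with q hq
  simp only [localFlow]
  rw [(chartAt E c).left_inv hq, hρ.add]

/-- The dictionary between generators on M and velocity fields in coordinates. For small t the orbit
stays in the chart domain, and the chain rule applies at t = 0. -/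
theorem IsSmoothFlow.mfderiv_symm_velocity (hρ : IsSmoothFlow (E := E) ρ) [IsManifold 𝓘(ℝ, E) ∞ M] {c : M} {z : E}
    (hz : z ∈ (chartAt E c).target) (τ : V) :
    mfderiv 𝓘(ℝ, E) 𝓘(ℝ, E) (chartAt E c).symm z (velocity (E := E) (localFlow E ρ c) τ z) =
      orbitField ρ τ ((chartAt E c).symm z) := by
  have h0 := hρ.localFlow_zero hz
  have h1 : HasFDerivAt (fun t : V => localFlow E ρ c (t, z))
      ((fderiv ℝ (localFlow E ρ c) (0, z)).comp (ContinuousLinearMap.inl ℝ V E)) 0 :=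
    HasFDerivAt.comp (0 : V) (g := localFlow E ρ c) (f := fun t : V => (t, z))
      ((hρ.contDiffAt_localFlow_zero hz).differentiableAt (by simp)).hasFDerivAt
      (hasFDerivAt_prodMk_left 0 z)
  have h2 : HasMFDerivAt 𝓘(ℝ, E) 𝓘(ℝ, E) (chartAt E c).symm (localFlow E ρ c (0, z))
      (mfderiv 𝓘(ℝ, E) 𝓘(ℝ, E) (chartAt E c).symm z) := by
    rw [h0]
    exact (mdifferentiableAt_atlas_symm (I := 𝓘(ℝ, E)) (chart_mem_atlas E c) hz).hasMFDerivAt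
  have h3 := HasMFDerivAt.comp (0 : V) (f := fun t : V => localFlow E ρ c (t, z)) h2
    h1.hasMFDerivAt
  have hc : Tendsto (fun t : V => (t, z)) (𝓝 0) (𝓝 (0, z)) :=
    (by fun_prop : Continuous fun t : V => (t, z)).tendsto _
  have h4 : (fun t : V => ρ t ((chartAt E c).symm z)) =ᶠ[𝓝 0]
      (chartAt E c).symm ∘ fun t : V => localFlow E ρ c (t, z) := by
    filter_upwards [hc.eventually (hρ.eventually_mem_source hz)] with t ht
    exact ((chartAt E c).left_inv ht).symm
  have h5 := (h3.congr_of_eventuallyEq h4).mfderiv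
  have h6 := congrArg (fun T : V →L[ℝ] E => T τ) h5
  exact h6.symm

end Flow

section RealManifold

variable {E : Type*} [NormedAddCommGroup E] [NormedSpace ℝ E]
  {M : Type*} [TopologicalSpace M] [ChartedSpace E M] [IsManifold 𝓘(ℝ, E) ∞ M]

theorem hasFDerivAt_comp_chart_symm {f : M → ℝ} {c : M} {z : E} (hz : z ∈ (chartAt E c).target)
    (hf : MDifferentiableAt 𝓘(ℝ, E) 𝓘(ℝ, ℝ) f ((chartAt E c).symm z)) :
    ∃ D : E →L[ℝ] ℝ, HasFDerivAt (fun z => f ((chartAt E c).symm z)) D z ∧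
      ∀ v, D v = diff E f ((chartAt E c).symm z)
        (mfderiv 𝓘(ℝ, E) 𝓘(ℝ, E) (chartAt E c).symm z v) := by
  have h1 := (mdifferentiableAt_atlas_symm (I := 𝓘(ℝ, E)) (chart_mem_atlas E c) hz).hasMFDerivAt
  have h2 := HasMFDerivAt.comp z hf.hasMFDerivAt h1
  exact ⟨_, h2.hasFDerivAt, fun v => rfl⟩

end RealManifold

/-! ### Vanishing of Ω on pairs of generators. -/

section Pairing

variable {V : Type*} [NormedAddCommGroup V] [NormedSpace ℝ V]
  {n : ℕ} {M : Type*} [TopologicalSpace M] [ChartedSpace (Model n) M]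
  [IsManifold 𝓘(ℂ, Model n) ω M]

/-- Locally, a twisted Hamiltonian vector field is Hamiltonian for the conformal Kähler form. -/
theorem inChart_twistedHamiltonian (S : LcKStructure n M) {φ h : M → ℝ} {c : M} {z : Model n}
    (hz : z ∈ (chartAt (Model n) c).target)
    (hφ : ContMDiffAt 𝓘(ℝ, Model n) 𝓘(ℝ, ℝ) ∞ φ ((chartAt (Model n) c).symm z))
    (hh : ContMDiff 𝓘(ℝ, Model n) 𝓘(ℝ, ℝ) ∞ h)
    (hθ : S.leeForm ((chartAt (Model n) c).symm z) =
      diff (Model n) φ ((chartAt (Model n) c).symm z))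
    {X : (x : M) → TangentSpace 𝓘(ℝ, Model n) x} {X' : Model n}
    (hX : mfderiv 𝓘(ℝ, Model n) 𝓘(ℝ, Model n) (chartAt (Model n) c).symm z X' =
      X ((chartAt (Model n) c).symm z))
    (hham : ∀ (x : M) (v : TangentSpace 𝓘(ℝ, Model n) x),
      S.Ω x ![X x, v] = twistedDiff S.leeForm h x v) (v : Model n) :
    Form.inChart (fun z => Real.exp (-φ z) • S.Ω z) c z ![X', v] =
      fderiv ℝ (fun z => Real.exp (-φ ((chartAt (Model n) c).symm z)) *
        h ((chartAt (Model n) c).symm z)) z v := by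
  obtain ⟨D, hD, hD'⟩ := hasFDerivAt_comp_chart_symm hz (hφ.mdifferentiableAt (by simp))
  obtain ⟨D₁, hD₁, hD₁'⟩ := hasFDerivAt_comp_chart_symm hz
    ((hh ((chartAt (Model n) c).symm z)).mdifferentiableAt (by simp))
  rw [(hD.fun_neg.exp.fun_mul hD₁).fderiv]
  set x := (chartAt (Model n) c).symm z with hx
  set w : TangentSpace 𝓘(ℝ, Model n) x :=
    mfderiv 𝓘(ℝ, Model n) 𝓘(ℝ, Model n) (chartAt (Model n) c).symm z v with hw
  have e1 : Form.inChart (fun z => Real.exp (-φ z) • S.Ω z) c z ![X', v] =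
      Real.exp (-φ x) * S.Ω x ![X x, w] := by
    rw [← hX]
    refine congrArg (fun u : Fin 2 → Model n => Real.exp (-φ x) * S.Ω x u) (funext fun i => ?_)
    fin_cases i <;> rfl
  rw [e1, hham]
  -- This is d(e^{-φ}h) = e^{-φ}(dh - h dφ) with dφ = θ.
  have e2 : twistedDiff S.leeForm h x w = D₁ v - h x * D v := by
    rw [hD', hD₁', twistedDiff, hθ]
    rfl
  rw [e2]
  simp only [add_apply, smul_apply,
    neg_apply, smul_eq_mul]
  ring

/-- On two generators of a twisted Hamiltonian action of a vector group, the fundamental form is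
locally a constant multiple of `e^φ`, where `φ` is a local potential of the Lee form. -/
theorem exists_pairing_eq_const_mul_exp (S : LcKStructure n M) {ρ : V → M → M}
    (hρ : IsSmoothFlow (E := Model n) ρ) {σ τ : V}
    (hσ : S.IsTwistedHamiltonianField (orbitField ρ σ))
    (hτ : S.IsTwistedHamiltonianField (orbitField ρ τ)) (c : M) :
    ∃ (φ : M → ℝ) (K : ℝ), ContMDiffAt 𝓘(ℝ, Model n) 𝓘(ℝ, ℝ) ∞ φ c ∧
      (∀ᶠ y in 𝓝 c, S.leeForm y = diff (Model n) φ y) ∧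
      ∀ᶠ y in 𝓝 c, S.Ω y ![orbitField ρ σ y, orbitField ρ τ y] = K * Real.exp (φ y) := by
  obtain ⟨U, φ, hU, hcU, hφ, hUφ⟩ := S.isLeeForm c
  obtain ⟨hX, hXs, hXh⟩ := hσ
  obtain ⟨hY, hYs, hYh⟩ := hτ
  let k : M → ℝ := fun y => Real.exp (-φ y) * S.Ω y ![orbitField ρ σ y, orbitField ρ τ y]
  have hk : ∀ y ∈ U, HasMFDerivAt 𝓘(ℝ, Model n) 𝓘(ℝ, ℝ) k y 0 := by
    intro y hy
    apply hasMFDerivAt_of_comp_chart_symm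
    -- The chart changes with y because `Form.d` at y is computed in the chart preferred at y.
    set e := chartAt (Model n) y with he
    have hys : y ∈ e.source := mem_chart_source _ y
    have hyt : e y ∈ e.target := e.map_source hys
    have hev : ∀ᶠ z in 𝓝 (e y), z ∈ e.target ∧ e.symm z ∈ U := by
      refine (e.open_target.eventually_mem hyt).and
        ((e.continuousAt_symm hyt).eventually (hU.mem_nhds ?_))
      rwa [e.left_inv hys]
    have hA := (hρ.contDiffAt_localFlow_zero (c := y) hyt).of_le (m := 2) ENat.LEInfty.out
    have hφy : ∀ z ∈ U, ContMDiffAt 𝓘(ℝ, Model n) 𝓘(ℝ, ℝ) ∞ φ z := fun z hz =>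
      hφ.contMDiffAt (hU.mem_nhds hz)
    have hF : ∀ h : M → ℝ, ContMDiff 𝓘(ℝ, Model n) 𝓘(ℝ, ℝ) ∞ h →
        ContDiffAt ℝ 2 (fun z => Real.exp (-φ (e.symm z)) * h (e.symm z)) (e y) := by
      intro h hh
      have h1 : ContDiffAt ℝ ∞ (fun z => φ (e.symm z)) (e y) := by
        refine contDiffAt_comp_chart_symm hyt ?_
        exact hφy _ hev.self_of_nhds.2
      have h2 : ContDiffAt ℝ ∞ (fun z => h (e.symm z)) (e y) :=
        contDiffAt_comp_chart_symm hyt (hh _)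
      exact (h1.neg.exp.mul h2).of_le ENat.LEInfty.out
    have main := hasFDerivAt_hamiltonian_pair
      (differentiableAt_inChart S.metric (hφy y hy))
      (extDeriv_inChart_eq_zero (hUφ y hy).1)
      (hasFDerivAt_velocity hA σ).1 (hasFDerivAt_velocity hA τ).1 (hF hX hXs) (hF hY hYs)
      (by
        filter_upwards [hev] with z hz v
        exact inChart_twistedHamiltonian S hz.1 (hφy _ hz.2) hXs (hUφ _ hz.2).2
          (hρ.mfderiv_symm_velocity hz.1 σ) hXh v)
      (by
        filter_upwards [hev] with z hz v
        exact inChart_twistedHamiltonian S hz.1 (hφy _ hz.2) hYs (hUφ _ hz.2).2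
          (hρ.mfderiv_symm_velocity hz.1 τ) hYh v)
      (fderiv_velocity_comm hA (hρ.localFlow_zero hyt) (hρ.eventually_localFlow_add hyt) σ τ)
    refine main.congr_of_eventuallyEq ?_
    filter_upwards [hev] with z hz
    simp only [k]
    rw [← hρ.mfderiv_symm_velocity hz.1 σ, ← hρ.mfderiv_symm_velocity hz.1 τ]
    refine congrArg (fun u : Fin 2 → Model n => Real.exp (-φ (e.symm z)) * S.Ω (e.symm z) u)
      (funext fun i => ?_)
    fin_cases i <;> rfl
  refine ⟨φ, k c, hφ.contMDiffAt (hU.mem_nhds hcU), ?_, ?_⟩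
  · filter_upwards [hU.mem_nhds hcU] with y hy using (hUφ y hy).2
  · filter_upwards [eventually_eq_of_hasMFDerivAt_zero hU hcU hk] with y hy
    rw [← hy]
    simp only [k]
    rw [mul_right_comm, ← Real.exp_add]
    simp

/-- The fundamental form vanishes on two generators of a twisted Hamiltonian action of a vector
group, if the structure is strict. -/
theorem pairing_eq_zero [ConnectedSpace M] (S : LcKStructure n M) (hS : S.IsStrict) {ρ : V → M → M}
    (hρ : IsSmoothFlow (E := Model n) ρ) {σ τ : V}
    (hσ : S.IsTwistedHamiltonianField (orbitField ρ σ))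
    (hτ : S.IsTwistedHamiltonianField (orbitField ρ τ)) (x : M) :
    S.Ω x ![orbitField ρ σ x, orbitField ρ τ x] = 0 := by
  set f : M → ℝ := fun y => S.Ω y ![orbitField ρ σ y, orbitField ρ τ y] with hf
  have hloc := exists_pairing_eq_const_mul_exp S hρ hσ hτ
  -- Since e^φ never vanishes, whether f vanishes near a point depends on the constant K alone.
  have hopen : IsOpen {y | f y = 0} := by
    rw [isOpen_iff_mem_nhds]
    intro y hy
    obtain ⟨φ, K, -, -, hK⟩ := hloc y
    have hK0 : K = 0 := by
      have := hK.self_of_nhds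
      change f y = _ at this
      rw [show f y = 0 from hy] at this
      simpa using this.symm
    filter_upwards [hK] with z hz
    change f z = _ at hz
    simp [hz, hK0]
  have hclosed : IsOpen {y | f y = 0}ᶜ := by
    rw [isOpen_iff_mem_nhds]
    intro y hy
    obtain ⟨φ, K, -, -, hK⟩ := hloc y
    have hK0 : K ≠ 0 := by
      rintro rfl
      have := hK.self_of_nhds
      rw [zero_mul] at this
      exact hy this
    filter_upwards [hK] with z hz hz0
    change f z = _ at hz
    rw [show f z = 0 from hz0] at hz
    exact mul_ne_zero hK0 (Real.exp_ne_zero _) hz.symm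
  rcases isClopen_iff.1 ⟨⟨hclosed⟩, hopen⟩ with h | h
  · exfalso
    -- `Real.log` is log |·| away from 0, so the sign of f is irrelevant: locally log |f| = log |K|
    -- + φ.
    refine hS ⟨fun y => Real.log (f y), ?_⟩
    have key : ∀ c : M, ContMDiffAt 𝓘(ℝ, Model n) 𝓘(ℝ, ℝ) ∞ (fun y => Real.log (f y)) c ∧
        S.leeForm c = diff (Model n) (fun y => Real.log (f y)) c := by
      intro c
      obtain ⟨φ, K, hφ, hθ, hK⟩ := hloc c
      have hK0 : K ≠ 0 := by
        rintro rfl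
        have := hK.self_of_nhds
        rw [zero_mul] at this
        exact (h ▸ (show c ∈ {y | f y = 0} from this) : c ∈ (∅ : Set M))
      have e : (fun y => Real.log (f y)) =ᶠ[𝓝 c] fun y => Real.log K + φ y := by
        filter_upwards [hK] with y hy
        change f y = _ at hy
        rw [hy, Real.log_mul hK0 (Real.exp_ne_zero _), Real.log_exp]
      refine ⟨?_, ?_⟩
      · exact (contMDiffAt_const.add hφ).congr_of_eventuallyEq e
      · rw [hθ.self_of_nhds]
        have h1 := (hφ.mdifferentiableAt (by simp)).hasMFDerivAt
        have h2 := (hasMFDerivAt_const (I := 𝓘(ℝ, Model n)) (I' := 𝓘(ℝ, ℝ)) (Real.log K) c).add h1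
        have h3 := (h2.congr_of_eventuallyEq e).mfderiv
        refine Eq.trans ?_ h3.symm
        exact (zero_add (mfderiv 𝓘(ℝ, Model n) 𝓘(ℝ, ℝ) φ c : Model n →L[ℝ] ℝ)).symm
    exact ⟨fun c => (key c).1, fun c => (key c).2⟩
  · exact (h ▸ Set.mem_univ x : x ∈ {y | f y = 0})

end Pairing

/-! ### Orbits, injectivity of the chart dictionary, trivial one-parameter groups. -/

section Flow

variable {V : Type*} [NormedAddCommGroup V] [NormedSpace ℝ V]
  {E : Type*} [NormedAddCommGroup E] [NormedSpace ℝ E]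
  {M : Type*} [TopologicalSpace M] [ChartedSpace E M] {ρ : V → M → M}

theorem velocity_sum {k : ℕ} (A : V × E → E) (c : Fin k → ℝ) (τ : Fin k → V) (z : E) :
    velocity A (∑ i, c i • τ i) z = ∑ i, c i • velocity A (τ i) z := by
  have h : ∀ σ : V, velocity A σ z =
      (fderiv ℝ A (0, z)).comp (ContinuousLinearMap.inl ℝ V E) σ := fun σ => rfl
  simp only [h, map_sum, map_smul]

theorem velocity_sub (A : V × E → E) (σ τ : V) (z : E) :
    velocity A (σ - τ) z = velocity A σ z - velocity A τ z := by
  have h : ∀ σ : V, velocity A σ z =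
      (fderiv ℝ A (0, z)).comp (ContinuousLinearMap.inl ℝ V E) σ := fun σ => rfl
  simp only [h, map_sub]

/-- The derivative of an orbit map at any time. -/
theorem IsSmoothFlow.hasMFDerivAt_orbit (hρ : IsSmoothFlow (E := E) ρ) (x : M) (t₀ : V) :
    ∃ D : V →L[ℝ] E, HasMFDerivAt 𝓘(ℝ, V) 𝓘(ℝ, E) (fun t => ρ t x) t₀ D ∧
      ∀ τ, D τ = orbitField ρ τ (ρ t₀ x) := by
  -- The orbit of x is that of ρ t₀ x delayed by t₀; 0 is written t₀ - t₀ to match the value of the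
  -- shift in the chain rule.
  have h1 : HasMFDerivAt 𝓘(ℝ, V) 𝓘(ℝ, E) (fun t : V => ρ t (ρ t₀ x)) (t₀ - t₀)
      (mfderiv 𝓘(ℝ, V) 𝓘(ℝ, E) (fun t : V => ρ t (ρ t₀ x)) 0) := by
    have : ContMDiff 𝓘(ℝ, V) 𝓘(ℝ, E) ∞ (fun t : V => ρ t (ρ t₀ x)) :=
      hρ.smooth.comp (contMDiff_id.prodMk contMDiff_const)
    rw [sub_self]
    exact ((this 0).mdifferentiableAt (by simp)).hasMFDerivAt
  have h2 : HasMFDerivAt 𝓘(ℝ, V) 𝓘(ℝ, V) (fun t : V => t - t₀) t₀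
      (ContinuousLinearMap.id ℝ V) := ((hasFDerivAt_id t₀).sub_const t₀).hasMFDerivAt
  have h3 := HasMFDerivAt.comp t₀ (f := fun t : V => t - t₀) h1 h2
  have e : ((fun t : V => ρ t (ρ t₀ x)) ∘ fun t : V => t - t₀) = fun t => ρ t x := by
    funext t
    simp only [Function.comp_apply, ← hρ.add, sub_add_cancel]
  rw [e] at h3
  exact ⟨_, h3, fun τ => rfl⟩

variable [IsManifold 𝓘(ℝ, E) ∞ M]

/-- Injectivity makes vanishing and linear independence of generators equivalent on M and in the
chart. -/
theorem IsSmoothFlow.exists_injective_velocity (hρ : IsSmoothFlow (E := E) ρ) {c : M} {z : E}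
    (hz : z ∈ (chartAt E c).target) :
    ∃ D : E →ₗ[ℝ] E, LinearMap.ker D = ⊥ ∧
      ∀ τ, D (velocity (localFlow E ρ c) τ z) = orbitField ρ τ ((chartAt E c).symm z) := by
  let D : E →L[ℝ] E := mfderiv 𝓘(ℝ, E) 𝓘(ℝ, E) (chartAt E c).symm z
  refine ⟨D, ?_, hρ.mfderiv_symm_velocity hz⟩
  exact LinearMap.ker_eq_bot.2
    ((mdifferentiable_chart (I := 𝓘(ℝ, E)) c).symm.mfderiv_injective hz)

theorem IsSmoothFlow.velocity_eq_zero_iff (hρ : IsSmoothFlow (E := E) ρ) {c : M} {z : E}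
    (hz : z ∈ (chartAt E c).target) (τ : V) :
    velocity (localFlow E ρ c) τ z = 0 ↔
      (orbitField ρ τ ((chartAt E c).symm z) : E) = 0 := by
  obtain ⟨D, hD, h⟩ := hρ.exists_injective_velocity hz
  constructor
  · intro h0
    refine Eq.trans (h τ).symm ?_
    rw [h0]
    exact map_zero D
  · intro h0
    exact (LinearMap.ker_eq_bot'.1 hD) _ ((h τ).trans h0)

/-- If a generator vanishes identically, its one-parameter group acts trivially. -/
theorem IsSmoothFlow.eq_of_orbitField_eq_zero [T2Space M] [CompleteSpace E]
    (hρ : IsSmoothFlow (E := E) ρ) {τ : V} (h0 : ∀ x : M, (orbitField ρ τ x : E) = 0)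
    (x : M) (t : ℝ) : ρ (t • τ) x = x := by
  have hs : ContMDiff 𝓘(ℝ, E) 𝓘(ℝ, E).tangent 1
      (fun x : M => (⟨x, 0⟩ : TangentBundle 𝓘(ℝ, E) M)) :=
    Bundle.contMDiff_zeroSection ℝ (TangentSpace 𝓘(ℝ, E) : M → Type _)
  have e1 : ∀ r : ℝ, ((1 : ℝ →L[ℝ] ℝ).smulRight (0 : E)) r = 0 := fun r => by simp
  -- The orbit and the constant curve are both integral curves of the zero field, so uniqueness
  -- identifies them.
  have h1 : IsMIntegralCurve (I := 𝓘(ℝ, E)) (fun t : ℝ => ρ (t • τ) x)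
      (fun x : M => (0 : TangentSpace 𝓘(ℝ, E) x)) := by
    intro t
    obtain ⟨D, hD, hD'⟩ := hρ.hasMFDerivAt_orbit x (t • τ)
    have h2 : HasMFDerivAt 𝓘(ℝ, ℝ) 𝓘(ℝ, V) (fun t : ℝ => t • τ) t
        ((1 : ℝ →L[ℝ] ℝ).smulRight τ) :=
      ((hasFDerivAt_id t).smul_const τ).hasMFDerivAt
    have h3 := HasMFDerivAt.comp t (f := fun t : ℝ => t • τ) hD h2
    have e2 : ∀ r : ℝ, (D.comp ((1 : ℝ →L[ℝ] ℝ).smulRight τ)) r = 0 := fun r => by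
      refine (D.map_smul r τ).trans ?_
      have : D τ = 0 := (hD' τ).trans (h0 _)
      rw [this, smul_zero]
    refine h3.congr_mfderiv ?_
    exact ContinuousLinearMap.ext fun r => (e2 r).trans (e1 r).symm
  have h2 : IsMIntegralCurve (I := 𝓘(ℝ, E)) (fun _ : ℝ => x)
      (fun x : M => (0 : TangentSpace 𝓘(ℝ, E) x)) := by
    intro t
    refine (hasMFDerivAt_const x t).congr_mfderiv ?_
    refine ContinuousLinearMap.ext fun r => ?_
    exact (e1 r).symm
  have h3 := isMIntegralCurve_Ioo_eq_of_contMDiff_boundaryless (t₀ := 0) hs h1 h2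
    (by simp [hρ.zero])
  exact congrFun h3 t

end Flow

/-! ### Holomorphic actions with isotropic orbits: the dimension bound. -/

section HolomorphicFlow

variable {V : Type*} [NormedAddCommGroup V] [NormedSpace ℝ V]
  {n : ℕ} {M : Type*} [TopologicalSpace M] [ChartedSpace (Model n) M]
  [IsManifold 𝓘(ℂ, Model n) ω M] {ρ : V → M → M}

/-- The generators of an action by holomorphic maps are holomorphic in charts. -/
theorem IsSmoothFlow.differentiableAt_velocity_localFlow (hρ : IsSmoothFlow (E := Model n) ρ)
    (hhol : ∀ t, MDifferentiable 𝓘(ℂ, Model n) 𝓘(ℂ, Model n) (ρ t)) {c : M} {z : Model n}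
    (hz : z ∈ (chartAt (Model n) c).target) (τ : V) :
    DifferentiableAt ℂ (velocity (localFlow (Model n) ρ c) τ) z := by
  refine differentiableAt_velocity
    ((hρ.contDiffAt_localFlow_zero hz).of_le ENat.LEInfty.out) ?_ τ
  have hc : Tendsto (fun t : V => (t, z)) (𝓝 0) (𝓝 (0, z)) :=
    (by fun_prop : Continuous fun t : V => (t, z)).tendsto _
  filter_upwards [hc.eventually (hρ.eventually_mem_source hz)] with t ht
  have h1 := mdifferentiableAt_atlas_symm (I := 𝓘(ℂ, Model n)) (chart_mem_atlas (Model n) c) hz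
  have h2 := MDifferentiableAt.comp z (hhol t _) h1
  have h3 := mdifferentiableAt_atlas (I := 𝓘(ℂ, Model n)) (chart_mem_atlas (Model n) c) ht
  have h4 := MDifferentiableAt.comp z (g := chartAt (Model n) c)
    (f := ρ t ∘ (chartAt (Model n) c).symm) h3 h2
  exact h4.differentiableAt

/-- The identity theorem for generators of holomorphic actions. -/
theorem IsSmoothFlow.orbitField_eq_zero [ConnectedSpace M] (hρ : IsSmoothFlow (E := Model n) ρ)
    (hhol : ∀ t, MDifferentiable 𝓘(ℂ, Model n) 𝓘(ℂ, Model n) (ρ t)) {τ : V} {x₀ : M}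
    (h0 : ∀ᶠ x in 𝓝 x₀, (orbitField ρ τ x : Model n) = 0) (x : M) :
    (orbitField ρ τ x : Model n) = 0 := by
  let S : Set M := {y | ∀ᶠ x in 𝓝 y, (orbitField ρ τ x : Model n) = 0}
  have hSo : IsOpen S := isOpen_setOfPred_eventually_nhds
  have hSc : IsClosed S := by
    refine isClosed_of_closure_subset fun y hy => ?_
    set e := chartAt (Model n) y with he
    have hys : y ∈ e.source := mem_chart_source _ y
    have hyt : e y ∈ e.target := e.map_source hys
    obtain ⟨r, hr, hb⟩ := Metric.isOpen_iff.1 e.open_target _ hyt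
    have hev : ∀ᶠ w in 𝓝 y, w ∈ e.source ∧ e w ∈ Metric.ball (e y) r :=
      (e.open_source.eventually_mem hys).and
        ((e.continuousAt hys).eventually (Metric.ball_mem_nhds _ hr))
    -- A coordinate ball at the limit point y contains some w near which the field vanishes; the
    -- identity theorem spreads this over the ball.
    obtain ⟨w, ⟨hws, hwb⟩, hwS⟩ := mem_closure_iff_nhds.1 hy _ hev
    have hd : DifferentiableOn ℂ (velocity (localFlow (Model n) ρ y) τ) (Metric.ball (e y) r) :=
      fun z hz =>
        (hρ.differentiableAt_velocity_localFlow hhol (hb hz) τ).differentiableWithinAt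
    have hw0 : ∀ᶠ z in 𝓝 (e w), velocity (localFlow (Model n) ρ y) τ z = 0 := by
      have hc := e.continuousAt_symm (hb hwb)
      rw [ContinuousAt, e.left_inv hws] at hc
      filter_upwards [hc.eventually hwS, e.open_target.mem_nhds (hb hwb)] with z hz hzt
      exact (hρ.velocity_eq_zero_iff hzt τ).2 hz
    change ∀ᶠ x in 𝓝 y, (orbitField ρ τ x : Model n) = 0
    filter_upwards [hev] with v hv
    have := (hρ.velocity_eq_zero_iff (hb hv.2) τ).1 (eqOn_zero_ball hd hwb hw0 hv.2)
    rwa [e.left_inv hv.1] at this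
  have hS : S = Set.univ := IsClopen.eq_univ ⟨hSc, hSo⟩ ⟨x₀, h0⟩
  have hx : x ∈ S := hS ▸ Set.mem_univ x
  exact Eventually.self_of_nhds (p := fun x => (orbitField ρ τ x : Model n) = 0) hx

/-- Vectors spanning an isotropic real subspace and independent over `ℝ` are independent
over `ℂ`. -/
theorem HermitianMetric.linearIndependent_of_isotropic (g : HermitianMetric n M) (x : M) {k : ℕ}
    {u : Fin k → Model n} (hu : LinearIndependent ℝ u)
    (h0 : ∀ i j, g.fundamentalForm x ![u i, u j] = 0) : LinearIndependent ℂ u := by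
  rw [Fintype.linearIndependent_iff] at hu ⊢
  intro c hc
  let B : Model n →L[ℝ] Model n →L[ℝ] ℝ := g.inner x
  have hB0 : ∀ i j, B (Complex.I • u i) (u j) = 0 := h0
  -- The relation reads a + i b = 0 with a, b in the real span of u. Isotropy gives g(i b, a) = 0,
  -- hence g(a, a) = 0.
  set a : Model n := ∑ i, (c i).re • u i with ha
  set b : Model n := ∑ i, (c i).im • u i with hb
  have hab : a + Complex.I • b = 0 := by
    rw [← hc, ha, hb, Finset.smul_sum, ← Finset.sum_add_distrib]
    refine Finset.sum_congr rfl fun i _ => ?_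
    conv_rhs => rw [← Complex.re_add_im (c i), add_smul, mul_comm, mul_smul]
    simp only [Complex.coe_smul]
  have hbj : ∀ j, B (Complex.I • b) (u j) = 0 := fun j => by
    rw [hb, Finset.smul_sum, map_sum, _root_.sum_apply]
    refine Finset.sum_eq_zero fun i _ => ?_
    rw [smul_comm, map_smul, _root_.smul_apply, hB0, smul_zero]
  have hba : B (Complex.I • b) a = 0 := by
    rw [ha, map_sum]
    refine Finset.sum_eq_zero fun j _ => ?_
    rw [map_smul, hbj, smul_zero]
  have ha0 : a = 0 := by
    by_contra hne
    have hpos : 0 < B a a := g.pos x a hne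
    have e : a = -(Complex.I • b) := eq_neg_of_add_eq_zero_left hab
    have : B a a = 0 := by
      nth_rw 1 [e]
      rw [map_neg, _root_.neg_apply, hba, neg_zero]
    exact hpos.ne' this
  have hb0 : b = 0 := by
    rw [ha0, zero_add] at hab
    exact (smul_eq_zero.1 hab).resolve_left Complex.I_ne_zero
  intro i
  exact Complex.ext (hu _ ha0 i) (hu _ hb0 i)

/-- For an effective holomorphic action with isotropic orbits, independent generators are
independent at some point. -/
theorem IsSmoothFlow.exists_linearIndependent [ConnectedSpace M] [T2Space M]
    (hρ : IsSmoothFlow (E := Model n) ρ)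
    (hhol : ∀ t, MDifferentiable 𝓘(ℂ, Model n) 𝓘(ℂ, Model n) (ρ t))
    (heff : ∀ τ : V, (∀ (t : ℝ) (x : M), ρ (t • τ) x = x) → τ = 0)
    (g : HermitianMetric n M)
    (hiso : ∀ (σ τ : V) (x : M), g.fundamentalForm x ![orbitField ρ σ x, orbitField ρ τ x] = 0)
    {k : ℕ} (b : Fin k → V) (hb : LinearIndependent ℝ b) :
    ∃ x : M, LinearIndependent ℝ (fun i => (orbitField ρ (b i) x : Model n)) := by
  induction k with
  | zero => exact ⟨Classical.arbitrary M, linearIndependent_empty_type⟩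
  | succ k ih =>
    by_contra! hcon
    have hbs : Fin.snoc (Fin.init b) (b (Fin.last k)) = b := Fin.snoc_init_self b
    have hb' := hb
    rw [← hbs, linearIndependent_finSnoc] at hb'
    obtain ⟨x₀, hx₀⟩ := ih (Fin.init b) hb'.1
    set e := chartAt (Model n) x₀ with he
    have hxs : x₀ ∈ e.source := mem_chart_source _ x₀
    have hxt : e x₀ ∈ e.target := e.map_source hxs
    let v : V → Model n → Model n := velocity (localFlow (Model n) ρ x₀)
    have hvd : ∀ τ, ∀ᶠ z in 𝓝 (e x₀), DifferentiableAt ℂ (v τ) z := fun τ => by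
      filter_upwards [e.open_target.mem_nhds hxt] with z hz
      exact hρ.differentiableAt_velocity_localFlow hhol hz τ
    have hx₀' : LinearIndependent ℝ
        (fun i => (orbitField ρ (Fin.init b i) (e.symm (e x₀)) : Model n)) := by
      rwa [e.left_inv hxs]
    -- Isotropy enters here: `exists_const_coeff` needs independence over ℂ, while the induction
    -- gives it only over ℝ.
    have hvC : LinearIndependent ℂ fun i => v (Fin.init b i) (e x₀) := by
      have h1 := g.linearIndependent_of_isotropic (e.symm (e x₀)) hx₀' (fun i j => hiso _ _ _)
      obtain ⟨D, hD⟩ := exists_mfderiv_chart_symm x₀ hxt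
      refine LinearIndependent.of_comp (D : Model n →ₗ[ℂ] Model n) ?_
      have hDv : (D : Model n →ₗ[ℂ] Model n) ∘ (fun i => v (Fin.init b i) (e x₀)) =
          fun i => (orbitField ρ (Fin.init b i) (e.symm (e x₀)) : Model n) :=
        funext fun i => (hD _).symm.trans (hρ.mfderiv_symm_velocity hxt _)
      rw [hDv]
      exact h1
    have hvR : LinearIndependent ℝ fun i => v (Fin.init b i) (e x₀) :=
      hvC.restrict_scalars' ℝ
    have hopen : ∀ᶠ z in 𝓝 (e x₀), LinearIndependent ℝ fun i => v (Fin.init b i) z := by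
      have hc : ContinuousAt (fun z i => v (Fin.init b i) z) (e x₀) :=
        continuousAt_pi.2 fun i => (hvd _).self_of_nhds.continuousAt
      exact hc.eventually (isOpen_setOfPred_linearIndependent.mem_nhds hvR)
    have hspan : ∀ᶠ z in 𝓝 (e x₀), ∃ c : Fin k → ℝ,
        v (b (Fin.last k)) z = ∑ i, c i • v (Fin.init b i) z := by
      filter_upwards [hopen, e.open_target.mem_nhds hxt] with z hz hzt
      obtain ⟨D, hD, hD'⟩ := hρ.exists_injective_velocity (c := x₀) hzt
      have h1 : ¬ LinearIndependent ℝ fun i => v (b i) z := by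
        intro h
        refine hcon (e.symm z) ?_
        have hDv : D ∘ (fun i => v (b i) z) =
            fun i => (orbitField ρ (b i) (e.symm z) : Model n) := funext fun i => hD' _
        have := (LinearMap.linearIndependent_iff D hD).2 h
        rw [hDv] at this
        exact this
      have h2 : (fun i => v (b i) z) =
          Fin.snoc (fun i => v (Fin.init b i) z) (v (b (Fin.last k)) z) := by
        funext i
        refine Fin.lastCases ?_ (fun j => ?_) i
        · simp
        · simp [Fin.init]
      rw [h2, linearIndependent_finSnoc] at h1
      have h3 : v (b (Fin.last k)) z ∈ Submodule.span ℝ (Set.range fun i => v (Fin.init b i) z) := by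
        by_contra hn
        exact h1 ⟨hz, hn⟩
      obtain ⟨c, hc⟩ := (Submodule.mem_span_range_iff_exists_fun ℝ).1 h3
      exact ⟨c, hc.symm⟩
    obtain ⟨c, hc⟩ := exists_const_coeff (fun i => hvd _) (hvd _) hvC hspan
    -- With constant coefficients, the relation between fields becomes the vanishing of a single
    -- generator near x₀.
    have hzero : ∀ᶠ x in 𝓝 x₀,
        (orbitField ρ (b (Fin.last k) - ∑ i, c i • Fin.init b i) x : Model n) = 0 := by
      filter_upwards [(e.continuousAt hxs).eventually hc, e.open_source.mem_nhds hxs,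
        (e.continuousAt hxs).eventually (e.open_target.mem_nhds hxt)] with x hx hxs' hxt'
      have h1 : v (b (Fin.last k) - ∑ i, c i • Fin.init b i) (e x) = 0 := by
        simp only [v]
        rw [velocity_sub, velocity_sum]
        exact sub_eq_zero.2 hx
      have h2 := (hρ.velocity_eq_zero_iff hxt' _).1 h1
      rwa [e.left_inv hxs'] at h2
    have h3 := heff _ fun t x =>
      hρ.eq_of_orbitField_eq_zero (hρ.orbitField_eq_zero hhol hzero) x t
    exact hb'.2 (sub_eq_zero.1 h3 ▸
      (Submodule.mem_span_range_iff_exists_fun ℝ).2 ⟨c, rfl⟩)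

/-- An effective holomorphic action of a vector group with isotropic orbits has dimension at most
the complex dimension of the manifold. -/
theorem IsSmoothFlow.finrank_le [ConnectedSpace M] [T2Space M] [FiniteDimensional ℝ V]
    (hρ : IsSmoothFlow (E := Model n) ρ)
    (hhol : ∀ t, MDifferentiable 𝓘(ℂ, Model n) 𝓘(ℂ, Model n) (ρ t))
    (heff : ∀ τ : V, (∀ (t : ℝ) (x : M), ρ (t • τ) x = x) → τ = 0)
    (g : HermitianMetric n M)
    (hiso : ∀ (σ τ : V) (x : M), g.fundamentalForm x ![orbitField ρ σ x, orbitField ρ τ x] = 0) :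
    Module.finrank ℝ V ≤ n := by
  obtain ⟨x, hx⟩ := hρ.exists_linearIndependent hhol heff g hiso _
    (Module.finBasis ℝ V).linearIndependent
  have h := (g.linearIndependent_of_isotropic x hx fun i j => hiso _ _ _).fintype_card_le_finrank
  simpa using h

end HolomorphicFlow

/-! ### The exponential map of the torus and its differential. -/

section TorusExp

/-- The exponential map of the torus. -/
def torusExp (m : ℕ) (t : Fin m → ℝ) : Torus m := fun i => Circle.exp (t i)

theorem torusExp_zero (m : ℕ) : torusExp m 0 = 1 := funext fun _ => Circle.exp_zero

theorem torusExp_add {m : ℕ} (s t : Fin m → ℝ) :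
    torusExp m (s + t) = torusExp m s * torusExp m t := funext fun _ => Circle.exp_add _ _

theorem surjective_torusExp (m : ℕ) : Function.Surjective (torusExp m) := fun a =>
  ⟨fun i => Complex.arg (a i), funext fun i => Circle.exp_arg (a i)⟩

theorem eq_zero_of_torusExp_smul_eq_one {m : ℕ} {τ : Fin m → ℝ}
    (h : ∀ t : ℝ, torusExp m (t • τ) = 1) : τ = 0 := by
  by_contra hne
  obtain ⟨i, hi⟩ := Function.ne_iff.1 hne
  -- Time 1/τ i brings coordinate i to e^{i}, which has argument 1 because 1 lies in (-π, π], and so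
  -- is not 1.
  have h1 : Circle.exp 1 = 1 := by
    have := congrFun (h (τ i)⁻¹) i
    simpa [torusExp, inv_mul_cancel₀ hi] using this
  have h2 := Circle.arg_exp (x := 1) (by linarith [Real.pi_pos]) (by linarith [Real.pi_gt_three])
  rw [h1] at h2
  simp at h2

theorem continuous_torusExp (m : ℕ) : Continuous (torusExp m) :=
  continuous_pi fun i => Circle.exp.continuous.comp (continuous_apply i)

theorem contMDiff_torusExp (m : ℕ) :
    ContMDiff 𝓘(ℝ, Fin m → ℝ) (torusModel m) ∞ (torusExp m) := by
  intro t
  rw [contMDiffAt_iff]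
  refine ⟨(continuous_torusExp m).continuousAt, ?_⟩
  rw [contDiffWithinAt_pi]
  intro i
  have h : ContMDiffAt 𝓘(ℝ, Fin m → ℝ) (𝓡 1) ∞ (fun t : Fin m → ℝ => Circle.exp (t i)) t :=
    (contMDiff_circleExp.comp (contDiff_apply ℝ ℝ i).contMDiff) t
  exact (contMDiffAt_iff.1 h).2

theorem hasMFDerivAt_torusExp {m : ℕ} (t : Fin m → ℝ) :
    HasMFDerivAt 𝓘(ℝ, Fin m → ℝ) (torusModel m) (torusExp m) t
      (ContinuousLinearMap.pi fun i =>
        (show ℝ →L[ℝ] EuclideanSpace ℝ (Fin 1) from mfderiv 𝓘(ℝ, ℝ) (𝓡 1) Circle.exp (t i)).comp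
          (ContinuousLinearMap.proj i)) := by
  refine ⟨(continuous_torusExp m).continuousAt, ?_⟩
  refine hasFDerivWithinAt_pi.2 fun i => ?_
  have h1 : HasMFDerivAt 𝓘(ℝ, ℝ) (𝓡 1) Circle.exp (t i)
      (mfderiv 𝓘(ℝ, ℝ) (𝓡 1) Circle.exp (t i)) :=
    ((contMDiff_circleExp (m := 1) (t i)).mdifferentiableAt (by simp)).hasMFDerivAt
  have h2 : HasMFDerivAt 𝓘(ℝ, Fin m → ℝ) 𝓘(ℝ, ℝ) (fun t : Fin m → ℝ => t i) t
      (ContinuousLinearMap.proj i) :=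
    (ContinuousLinearMap.proj (R := ℝ) (φ := fun _ : Fin m => ℝ) i).hasFDerivAt.hasMFDerivAt
  exact (HasMFDerivAt.comp t (f := fun t : Fin m → ℝ => t i) h1 h2).2

/-- Both tangent spaces are lines, so a nonzero differential suffices; composed with the inclusion
in ℂ it sends 1 to i e^{is} ≠ 0. -/
theorem surjective_mfderiv_circleExp (s : ℝ) :
    Function.Surjective (mfderiv 𝓘(ℝ, ℝ) (𝓡 1) Circle.exp s) := by
  have h1 : HasMFDerivAt 𝓘(ℝ, ℝ) (𝓡 1) Circle.exp s
      (mfderiv 𝓘(ℝ, ℝ) (𝓡 1) Circle.exp s) :=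
    ((contMDiff_circleExp (m := 1) s).mdifferentiableAt (by simp)).hasMFDerivAt
  have : Fact (Module.finrank ℝ ℂ = 1 + 1) := ⟨Complex.finrank_real_complex⟩
  have h2 : HasMFDerivAt (𝓡 1) 𝓘(ℝ, ℂ) (fun z : Circle => (z : ℂ)) (Circle.exp s)
      (mfderiv (𝓡 1) 𝓘(ℝ, ℂ) (fun z : Circle => (z : ℂ)) (Circle.exp s)) := by
    have hc : ContMDiff (𝓡 1) 𝓘(ℝ, ℂ) 1 (fun z : Circle => (z : ℂ)) :=
      contMDiff_coe_sphere (E := ℂ) (n := 1)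
    exact ((hc _).mdifferentiableAt (by simp)).hasMFDerivAt
  have h3 := (HasMFDerivAt.comp s h2 h1).hasFDerivAt
  have h4 : HasDerivAt (fun s : ℝ => Complex.exp (s * Complex.I))
      (Complex.exp (s * Complex.I) * (1 * Complex.I)) s :=
    ((Complex.ofRealCLM.hasDerivAt (x := s)).mul_const Complex.I).cexp
  have h5 := h4.hasFDerivAt.unique h3
  have hne : mfderiv 𝓘(ℝ, ℝ) (𝓡 1) Circle.exp s ≠ 0 := by
    intro h0
    rw [h0] at h5
    have h6 := congrArg (fun T : ℝ →L[ℝ] ℂ => T 1) h5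
    have h7 : (Complex.exp (s * Complex.I) * (1 * Complex.I)) = 0 := by
      refine Eq.trans ?_ (h6.trans ?_)
      · simp
      · exact map_zero (mfderiv (𝓡 1) 𝓘(ℝ, ℂ) (fun z : Circle => (z : ℂ)) (Circle.exp s))
    simp [Complex.exp_ne_zero] at h7
  let L : ℝ →ₗ[ℝ] EuclideanSpace ℝ (Fin 1) :=
    (show ℝ →L[ℝ] EuclideanSpace ℝ (Fin 1) from mfderiv 𝓘(ℝ, ℝ) (𝓡 1) Circle.exp s)
  have hL : L ≠ 0 := fun h => hne (ContinuousLinearMap.coe_injective h)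
  exact surjective_of_nonzero_of_finrank_eq_one (K := ℝ) finrank_euclideanSpace_fin (f := L) hL

theorem surjective_mfderiv_torusExp {m : ℕ} (t : Fin m → ℝ) :
    Function.Surjective (mfderiv 𝓘(ℝ, Fin m → ℝ) (torusModel m) (torusExp m) t) := by
  rw [(hasMFDerivAt_torusExp t).mfderiv]
  intro v
  choose w hw using fun i => surjective_mfderiv_circleExp (t i) (v i)
  exact ⟨w, funext hw⟩

end TorusExp

/-! ### The torus action as an action of ℝ^m. -/

section TorusAction

variable {n m : ℕ} {M : Type*} [TopologicalSpace M] [ChartedSpace (Model n) M]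
  [MulAction (Torus m) M] [ContMDiffSMul (torusModel m) 𝓘(ℝ, Model n) ∞ (Torus m) M]

/-- The action of the Lie algebra of the torus, as a vector group, through the exponential map. -/
def torusFlow (m : ℕ) (M : Type*) [MulAction (Torus m) M] (t : Fin m → ℝ) (x : M) : M :=
  torusExp m t • x

theorem isSmoothFlow_torusFlow : IsSmoothFlow (E := Model n) (torusFlow m M) where
  smooth := by
    have h1 : ContMDiff (𝓘(ℝ, Fin m → ℝ).prod 𝓘(ℝ, Model n))
        ((torusModel m).prod 𝓘(ℝ, Model n)) ∞
        (fun q : (Fin m → ℝ) × M => (torusExp m q.1, q.2)) :=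
      ((contMDiff_torusExp m).comp contMDiff_fst).prodMk contMDiff_snd
    exact (ContMDiffSMul.contMDiff_smul (I := torusModel m) (I' := 𝓘(ℝ, Model n))
      (G := Torus m) (M := M)).comp h1
  zero x := by rw [torusFlow, torusExp_zero, one_smul]
  add s t x := by rw [torusFlow, torusExp_add, mul_smul]; rfl

theorem hasMFDerivAt_orbitMap (a : Torus m) (x : M) :
    HasMFDerivAt (torusModel m) 𝓘(ℝ, Model n) (fun b : Torus m => b • x) a
      (mfderiv (torusModel m) 𝓘(ℝ, Model n) (fun b : Torus m => b • x) a) := by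
  have h : ContMDiff (torusModel m) 𝓘(ℝ, Model n) ∞ (fun b : Torus m => b • x) :=
    (ContMDiffSMul.contMDiff_smul (I := torusModel m) (I' := 𝓘(ℝ, Model n))
      (G := Torus m) (M := M)).comp (contMDiff_id.prodMk contMDiff_const)
  exact ((h a).mdifferentiableAt (by simp)).hasMFDerivAt

/-- Identifies vectors tangent to a torus orbit with values of generators of the ℝ^m-action, so
isotropy need only be tested on generators. At t = 0 it identifies the fundamental fields. -/
theorem mfderiv_orbitMap_torusExp (t : Fin m → ℝ) (x : M) (τ : Fin m → ℝ) :
    (mfderiv (torusModel m) 𝓘(ℝ, Model n) (fun b : Torus m => b • x) (torusExp m t)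
        (mfderiv 𝓘(ℝ, Fin m → ℝ) (torusModel m) (torusExp m) t τ) : Model n) =
      orbitField (torusFlow m M) τ (torusFlow m M t x) := by
  obtain ⟨D, hD, hD'⟩ := (isSmoothFlow_torusFlow (n := n) (m := m) (M := M)).hasMFDerivAt_orbit x t
  have h1 : HasMFDerivAt 𝓘(ℝ, Fin m → ℝ) (torusModel m) (torusExp m) t
      (mfderiv 𝓘(ℝ, Fin m → ℝ) (torusModel m) (torusExp m) t) :=
    (((contMDiff_torusExp m) t).mdifferentiableAt (by simp)).hasMFDerivAt
  have h2 := HasMFDerivAt.comp t (hasMFDerivAt_orbitMap (n := n) (torusExp m t) x) h1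
  have h3 := hasMFDerivAt_unique hD h2
  rw [← hD']
  exact (congrArg (fun T : (Fin m → ℝ) →L[ℝ] Model n => T τ) h3).symm

variable [IsManifold 𝓘(ℂ, Model n) ω M]

theorem isTwistedHamiltonianField_orbitField_torusFlow {S : LcKStructure n M}
    (htw : S.IsTwistedHamiltonianAction (torusModel m) (Torus m)) (τ : Fin m → ℝ) :
    S.IsTwistedHamiltonianField (orbitField (torusFlow m M) τ) := by
  obtain ⟨h, hh, hX⟩ := htw (mfderiv 𝓘(ℝ, Fin m → ℝ) (torusModel m) (torusExp m) 0 τ)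
  refine ⟨h, hh, fun x v => ?_⟩
  rw [← hX x v]
  have e := mfderiv_orbitMap_torusExp (n := n) (0 : Fin m → ℝ) x τ
  have e0 : torusFlow m M 0 x = x := (isSmoothFlow_torusFlow (n := n)).zero x
  rw [torusExp_zero, e0] at e
  refine congrArg (fun u : Model n => S.Ω x ![u, v]) ?_
  exact e.symm

end TorusAction

end LcK

end

/-- On a compact connected strict lcK manifold of complex dimension `n`, the orbits of an effective
twisted Hamiltonian holomorphic action of `T^m` are isotropic for `Ω`, and `m ≤ n`. -/
theorem proposition3p6 {n m : ℕ} {M : Type*}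
    [TopologicalSpace M] [T2Space M] [CompactSpace M] [ConnectedSpace M]
    [ChartedSpace (LcK.Model n) M] [IsManifold 𝓘(ℂ, LcK.Model n) ω M]
    (S : LcK.LcKStructure n M) (hstrict : S.IsStrict)
    [MulAction (LcK.Torus m) M]
    [ContMDiffSMul (LcK.torusModel m) 𝓘(ℝ, LcK.Model n) ∞ (LcK.Torus m) M]
    [FaithfulSMul (LcK.Torus m) M]
    (hhol : ∀ t : LcK.Torus m,
      MDifferentiable 𝓘(ℂ, LcK.Model n) 𝓘(ℂ, LcK.Model n) (fun x : M => t • x))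
    (htw : S.IsTwistedHamiltonianAction (LcK.torusModel m) (LcK.Torus m)) :
    (∀ x : M, LcK.IsIsotropicOrbit (LcK.torusModel m) (LcK.Torus m) S.Ω x) ∧ m ≤ n := by
  have hρ : LcK.IsSmoothFlow (E := LcK.Model n) (LcK.torusFlow m M) :=
    LcK.isSmoothFlow_torusFlow
  have hiso : ∀ (σ τ : Fin m → ℝ) (x : M),
      S.Ω x ![LcK.orbitField (LcK.torusFlow m M) σ x,
        LcK.orbitField (LcK.torusFlow m M) τ x] = 0 := fun σ τ x =>
    LcK.pairing_eq_zero S hstrict hρ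
      (LcK.isTwistedHamiltonianField_orbitField_torusFlow htw σ)
      (LcK.isTwistedHamiltonianField_orbitField_torusFlow htw τ) x
  constructor
  · intro x a v w
    -- The exponential map and its differentials are onto, so every orbit point and every pair of
    -- tangent vectors comes from ℝ^m.
    obtain ⟨t, rfl⟩ := LcK.surjective_torusExp m a
    obtain ⟨σ, rfl⟩ := LcK.surjective_mfderiv_torusExp t v
    obtain ⟨τ, rfl⟩ := LcK.surjective_mfderiv_torusExp t w
    refine Eq.trans ?_ (hiso σ τ (LcK.torusFlow m M t x))
    exact congrArg₂ (fun u u' : LcK.Model n => S.Ω (LcK.torusExp m t • x) ![u, u'])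
      (LcK.mfderiv_orbitMap_torusExp t x σ) (LcK.mfderiv_orbitMap_torusExp t x τ)
  · have h := hρ.finrank_le (fun t => hhol (LcK.torusExp m t)) (fun τ hτ => ?_) S.metric hiso
    · simpa using h
    -- Although ℝ^m acts with kernel, no line of it acts trivially: faithfulness would make its
    -- exponential constantly 1.
    · refine LcK.eq_zero_of_torusExp_smul_eq_one fun t => ?_
      refine FaithfulSMul.eq_of_smul_eq_smul (α := M) fun x => ?_
      rw [one_smul]
      exact hτ t x
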